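/- Let $\mathcal G$ be the star graph made of three half-lines $[0,\infty)$ joined at their common origin (the vertex). A state is a triple $\Psi=(\Psi_1,\Psi_2,\Psi_3)$ with complex-valued $\Psi_i\in H^1(\mathbb R^+)$. Put $\|\Psi\|^2=\sum_i\int_0^\infty|\Psi_i|^2$, $(\Phi,\Psi)=\sum_i\int_0^\infty\overline{\Phi_i}\Psi_i$ and $$E(\Psi)=\sum_{i=1}^3\Big(\tfrac12\int_0^\infty|\Psi_i'|^2-\tfrac14\int_0^\infty|\Psi_i|^4\Big).$$ For $M>0$ let $\Sigma_M$ be the set of states with $\|\Psi\|^2=M$ that are continuous at the vertex, i.e. $\Psi_1(0)=\Psi_2(0)=\Psi_3(0)$, with the topology of $H^1$. Let $\Delta$ be the Kirchhoff Laplacian, $(\Delta\Psi)_i=\Psi_i''$, on the states with $\Psi_i\in H^2(\mathbb R^+)$, continuous at the vertex, with $\sum_i\Psi_i'(0)=0$. A sesquisoliton is a state $$\Phi^x_{m_1,m_2}(x_1,x_2,x_3)=\Big(\tfrac{m_1}{\sqrt2}\tfrac1{\cosh(\frac{m_1}{2}x_1)},\ \tfrac{m_2}{2\sqrt2}\tfrac1{\cosh(\frac{m_2}{4}(x_2-x))},\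 \tfrac{m_2}{2\sqrt2}\tfrac1{\cosh(\frac{m_2}{4}(x_3+x))}\Big)$$ with $0<m_1\le m_2$, $x\ge0$ and $m_1=\frac{m_2}{2}\,\frac1{\cosh(\frac{m_2}{4}x)}$. Let $\mathcal S_M$ be the set of sesquisolitons with $\|\Phi^x_{m_1,m_2}\|^2=M$. **Theorem.** Let $M>0$ and $\Phi=\Phi^0_{M/3,2M/3}$. Then $\Phi\in\mathcal S_M\subset\Sigma_M$, and: 1. $\Phi$ lies in the domain of $\Delta$ and solves $-\Delta\Phi-|\Phi|^2\Phi+\omega\Phi=0$ with $\omega=M^2/36$. It is a critical point of $E$ on $\Sigma_M$ with Lagrange multiplier $\omega$: $E$ is Fréchet differentiable at $\Phi$ and $dE(\Phi)h+\omega\,\mathrm{Re}\,(\Phi,h)=0$ for every state $h$ that is continuous at the vertex (and in fact for every $h\in\bigoplus_{i=1}^3H^1(\mathbb R^+)$). 2. $\Phi$ is a saddle point of $E$ on $\Sigma_M$: it is a critical point and neither a local minimum nor a local maximum of $E|_{\Sigma_M}$. 3. $\mathcal S_M$ is a curve parametrized by $m_1$: there is a function $\xi$ on $(0,M/3]$ with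 $\xi(M/3)=0$ such that $m_1\mapsto\Phi^{\xi(m_1)}_{m_1,M-m_1}$ is a continuous map from $(0,M/3]$ onto $\mathcal S_M$, with values in sesquisolitons. Along it $E$ is strictly increasing in $m_1$, and $\Phi$, its endpoint $m_1=M/3$, is a maximum of $E$ on $\mathcal S_M$. 4. $\Phi$ is a minimum of $E$ on $\{\Psi\in\Sigma_M:\Psi_1=\Psi_2=\Psi_3\}$. -/

import Mathlib

open MeasureTheory Set Filter Topology

noncomputable section

namespace StarGraph

/-- The complex space `L²(ℝ⁺)`, with Lebesgue measure on `(0, ∞)`. -/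
abbrev L2 : Type := Lp ℂ 2 (volume.restrict (Ioi (0 : ℝ)))

/-- `v` is the weak derivative of `u` on the open half-line `(0, ∞)`. -/
def HasWeakDeriv (u v : L2) : Prop :=
  ∀ η : ℝ → ℝ, ContDiff ℝ (⊤ : ℕ∞) η → HasCompactSupport η → tsupport η ⊆ Ioi 0 →
    ∫ t in Ioi (0 : ℝ), deriv η t • u t = -∫ t in Ioi (0 : ℝ), η t • v t

theorem integrable_test_smul {η : ℝ → ℝ} (hη : Continuous η) (hc : HasCompactSupport η) (u : L2) :
    Integrable (fun t => η t • u t) (volume.restrict (Ioi (0 : ℝ))) := by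
  have h1 : MemLp η 2 (volume.restrict (Ioi (0 : ℝ))) := hη.memLp_of_hasCompactSupport hc
  exact memLp_one_iff_integrable.mp ((Lp.memLp u).smul h1)

/-- The Sobolev space `H¹(ℝ⁺)`: the square integrable functions whose weak derivative is square
integrable. An element is stored as the pair `(u, u')`, so that the topology is the one of the
Sobolev norm: `u` and `u'` converge in `L²`. -/
def H1 : Submodule ℂ (L2 × L2) where
  carrier := {p | HasWeakDeriv p.1 p.2}
  zero_mem' := by
    intro η _ _ _
    have h : ((0 : L2) : ℝ → ℂ) =ᵐ[volume.restrict (Ioi (0 : ℝ))] 0 := Lp.coeFn_zero _ _ _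
    have e1 : ∫ t in Ioi (0 : ℝ), deriv η t • (0 : L2) t = 0 :=
      integral_eq_zero_of_ae (by filter_upwards [h] with t ht; rw [ht]; exact smul_zero _)
    have e2 : ∫ t in Ioi (0 : ℝ), η t • (0 : L2) t = 0 :=
      integral_eq_zero_of_ae (by filter_upwards [h] with t ht; rw [ht]; exact smul_zero _)
    change ∫ t in Ioi (0 : ℝ), deriv η t • (0 : L2) t = -∫ t in Ioi (0 : ℝ), η t • (0 : L2) t
    rw [e1, e2, neg_zero]
  add_mem' := by
    intro p q hp hq η h1 h2 h3
    have hη' : Continuous (deriv η) := h1.continuous_deriv (by simp)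
    have e1 : ∫ t in Ioi (0 : ℝ), deriv η t • (p.1 + q.1) t
        = ∫ t in Ioi (0 : ℝ), (deriv η t • p.1 t + deriv η t • q.1 t) :=
      integral_congr_ae (by
        filter_upwards [Lp.coeFn_add p.1 q.1] with t ht; rw [ht, Pi.add_apply, smul_add])
    have e2 : ∫ t in Ioi (0 : ℝ), η t • (p.2 + q.2) t
        = ∫ t in Ioi (0 : ℝ), (η t • p.2 t + η t • q.2 t) :=
      integral_congr_ae (by
        filter_upwards [Lp.coeFn_add p.2 q.2] with t ht; rw [ht, Pi.add_apply, smul_add])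
    rw [integral_add (integrable_test_smul hη' h2.deriv _)
      (integrable_test_smul hη' h2.deriv _)] at e1
    rw [integral_add (integrable_test_smul h1.continuous h2 _)
      (integrable_test_smul h1.continuous h2 _)] at e2
    have e3 := hp η h1 h2 h3
    have e4 := hq η h1 h2 h3
    change ∫ t in Ioi (0 : ℝ), deriv η t • (p.1 + q.1) t
      = -∫ t in Ioi (0 : ℝ), η t • (p.2 + q.2) t
    rw [e1, e2, e3, e4]; ring
  smul_mem' := by
    intro c p hp η h1 h2 h3
    have e1 : ∫ t in Ioi (0 : ℝ), deriv η t • (c • p.1) t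
        = ∫ t in Ioi (0 : ℝ), c • (deriv η t • p.1 t) :=
      integral_congr_ae (by
        filter_upwards [Lp.coeFn_smul c p.1] with t ht
        simp only [ht, Pi.smul_apply]; rw [smul_comm])
    have e2 : ∫ t in Ioi (0 : ℝ), η t • (c • p.2) t
        = ∫ t in Ioi (0 : ℝ), c • (η t • p.2 t) :=
      integral_congr_ae (by
        filter_upwards [Lp.coeFn_smul c p.2] with t ht
        simp only [ht, Pi.smul_apply]; rw [smul_comm])
    change ∫ t in Ioi (0 : ℝ), deriv η t • (c • p.1) t
      = -∫ t in Ioi (0 : ℝ), η t • (c • p.2) t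
    rw [e1, e2, integral_smul, integral_smul, hp η h1 h2 h3, smul_neg]

/-- `H¹(𝒢) = ⨁ᵢ H¹(ℝ⁺)` for the star graph `𝒢` with three edges (edge `1, 2, 3` has index
`0, 1, 2`). The norm is the largest of the norms of the components, which is equivalent to the
Hilbert norm. -/
abbrev H1Graph : Type := Fin 3 → H1

/-- The component `Ψᵢ`, as an element of `L²(ℝ⁺)`. -/
def comp (Ψ : H1Graph) (i : Fin 3) : L2 := (Ψ i).1.1

/-- The weak derivative `Ψᵢ'`, as an element of `L²(ℝ⁺)`. -/
def dcomp (Ψ : H1Graph) (i : Fin 3) : L2 := (Ψ i).1.2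

/-- The boundary value at `0` of `u` is `c`: there is a representative of `u` that is continuous on
`[0, ∞)` and takes the value `c` at `0`. -/
def HasTrace (u : L2) (c : ℂ) : Prop :=
  ∃ f : ℝ → ℂ, ContinuousOn f (Ici 0) ∧ u =ᵐ[volume.restrict (Ioi (0 : ℝ))] f ∧ f 0 = c

/-- `Ψ₁(0) = Ψ₂(0) = Ψ₃(0)`. -/
def ContinuousAtVertex (Ψ : H1Graph) : Prop :=
  ∃ c : ℂ, ∀ i, HasTrace (comp Ψ i) c

/-- `Ψ` lies in the domain of the Kirchhoff Laplacian (it is in `H²` on each edge, continuous at the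
vertex, and `Ψ₁'(0) + Ψ₂'(0) + Ψ₃'(0) = 0`) and `ΔΨ = w`. -/
def HasKirchhoffLaplacian (Ψ : H1Graph) (w : Fin 3 → L2) : Prop :=
  (∀ i, HasWeakDeriv (dcomp Ψ i) (w i)) ∧ ContinuousAtVertex Ψ ∧
    ∃ d : Fin 3 → ℂ, (∀ i, HasTrace (dcomp Ψ i) (d i)) ∧ ∑ i, d i = 0

/-- The mass `‖Ψ‖²`, the squared `L²(𝒢)` norm. -/
def mass (Ψ : H1Graph) : ℝ := ∑ i, ‖comp Ψ i‖ ^ 2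

/-- The hermitian product of `L²(𝒢)`, antilinear in the first argument. -/
def l2Inner (Φ Ψ : H1Graph) : ℂ := ∑ i, inner ℂ (comp Φ i) (comp Ψ i)

/-- The energy `E(Ψ) = ½ ‖Ψ'‖² - ¼ ‖Ψ‖₄⁴`. -/
def energy (Ψ : H1Graph) : ℝ :=
  ∑ i, (1 / 2 * ‖dcomp Ψ i‖ ^ 2 - 1 / 4 * ∫ t in Ioi (0 : ℝ), ‖comp Ψ i t‖ ^ 4)

/-- The constraint manifold: the states of finite energy, continuous at the vertex, of mass `M`. -/
def massSphere (M : ℝ) : Set H1Graph := {Ψ | ContinuousAtVertex Ψ ∧ mass Ψ = M}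

/-- `Φ` solves `-ΔΨ - |Ψ|²Ψ + om Ψ = 0`, where `Δ` is the Kirchhoff Laplacian. -/
def SolvesStationaryNLS (Φ : H1Graph) (om : ℝ) : Prop :=
  ∃ w : Fin 3 → L2, HasKirchhoffLaplacian Φ w ∧
    ∀ i, ∀ᵐ t ∂(volume.restrict (Ioi (0 : ℝ))),
      -(w i t) - (‖comp Φ i t‖ ^ 2 : ℝ) * comp Φ i t + (om : ℂ) * comp Φ i t = 0

/-- `Φ` is a critical point of the energy on the sphere of mass `M`, with Lagrange multiplier `om`:
the energy is (real) Fréchet differentiable at `Φ` and `dE(Φ) h + om Re (Φ, h) = 0` for every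
`h` that is continuous at the vertex, that is, `Φ` is a critical point of `E + (om / 2) ‖·‖²`. -/
def IsCriticalWithMultiplier (M : ℝ) (Φ : H1Graph) (om : ℝ) : Prop :=
  Φ ∈ massSphere M ∧
    ∃ L : H1Graph →L[ℝ] ℝ, HasFDerivAt energy L Φ ∧
      ∀ h, ContinuousAtVertex h → L h + om * (l2Inner Φ h).re = 0

/-- A saddle point of the energy on the sphere of mass `M`: a critical point which is neither a local
minimum nor a local maximum. -/
def IsSaddlePoint (M : ℝ) (Φ : H1Graph) : Prop :=
  (∃ om, IsCriticalWithMultiplier M Φ om) ∧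
    ¬ IsLocalMinOn energy (massSphere M) Φ ∧ ¬ IsLocalMaxOn energy (massSphere M) Φ

/-- The element of `H¹(ℝ⁺)` given by a continuously differentiable function which is square
integrable on the half-line together with its derivative. -/
def ofFun (f : ℝ → ℂ) (hf : ContDiff ℝ 1 f) (h0 : MemLp f 2 (volume.restrict (Ioi (0 : ℝ))))
    (h1 : MemLp (deriv f) 2 (volume.restrict (Ioi (0 : ℝ)))) : H1 :=
  ⟨(h0.toLp f, h1.toLp (deriv f)), by
    intro η hη hc hs
    have e1 : ∫ t in Ioi (0 : ℝ), deriv η t • (h0.toLp f) t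
        = ∫ t in Ioi (0 : ℝ), deriv η t • f t :=
      integral_congr_ae (by filter_upwards [h0.coeFn_toLp] with t ht; rw [ht])
    have e2 : ∫ t in Ioi (0 : ℝ), η t • (h1.toLp (deriv f)) t
        = ∫ t in Ioi (0 : ℝ), η t • deriv f t :=
      integral_congr_ae (by filter_upwards [h1.coeFn_toLp] with t ht; rw [ht])
    change ∫ t in Ioi (0 : ℝ), deriv η t • (h0.toLp f) t
      = -∫ t in Ioi (0 : ℝ), η t • (h1.toLp (deriv f)) t
    have hη' : Continuous (deriv η) := hη.continuous_deriv (by simp)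
    have hf' : Continuous (deriv f) := hf.continuous_deriv (by simp)
    have hs' : tsupport (deriv η) ⊆ Ioi 0 := fun x hx => hs (tsupport_deriv_subset hx)
    rw [e1, e2, setIntegral_eq_integral_of_forall_compl_eq_zero,
      setIntegral_eq_integral_of_forall_compl_eq_zero]
    · have i1 : Integrable (fun t => η t • deriv f t) :=
        (hη.continuous.smul hf').integrable_of_hasCompactSupport (hc.smul_right)
      have i2 : Integrable (fun t => deriv η t • f t) :=
        (hη'.smul hf.continuous).integrable_of_hasCompactSupport (hc.deriv.smul_right)
      have i3 : Integrable (fun t => η t • f t) :=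
        (hη.continuous.smul hf.continuous).integrable_of_hasCompactSupport (hc.smul_right)
      have := integral_bilinear_hasDerivAt_right_eq_neg_left_of_integrable
        (L := ContinuousLinearMap.lsmul ℝ ℝ (E := ℂ)) (u := η) (v := f) (u' := deriv η)
        (v' := deriv f)
        (fun t _ => (hη.differentiable (by simp) t).hasDerivAt)
        (fun t _ => (hf.differentiable (by simp) t).hasDerivAt) i1 i2 i3
      simp only [ContinuousLinearMap.lsmul_apply] at this
      rw [this, neg_neg]
    · intro t ht
      rw [image_eq_zero_of_notMem_tsupport (fun h => ht (hs h)), zero_smul]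
    · intro t ht
      rw [image_eq_zero_of_notMem_tsupport (fun h => ht (hs' h)), zero_smul]⟩

/-- The profile `t ↦ A / cosh (a (t - y))`. -/
def sech (A a y : ℝ) (t : ℝ) : ℂ := ((A * (Real.cosh (a * (t - y)))⁻¹ : ℝ) : ℂ)

theorem hasDerivAt_sech (A a y t : ℝ) : HasDerivAt (sech A a y)
    ((-(A * a * Real.sinh (a * (t - y)) * (Real.cosh (a * (t - y)))⁻¹ ^ 2) : ℝ) : ℂ) t := by
  have hc := (Real.cosh_pos (a * (t - y))).ne'
  have h1 : HasDerivAt (fun t : ℝ => a * (t - y)) a t := by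
    simpa using ((hasDerivAt_id t).sub_const y).const_mul a
  have h2 := ((h1.cosh).inv hc).const_mul A
  have h3 := h2.ofReal_comp
  refine (h3.congr_deriv ?_ :)
  congr 1
  field_simp

theorem deriv_sech (A a y : ℝ) : deriv (sech A a y) = fun t =>
    ((-(A * a * Real.sinh (a * (t - y)) * (Real.cosh (a * (t - y)))⁻¹ ^ 2) : ℝ) : ℂ) :=
  funext fun t => (hasDerivAt_sech A a y t).deriv

theorem continuous_inv_cosh (a y : ℝ) : Continuous fun t : ℝ => (Real.cosh (a * (t - y)))⁻¹ :=
  (Real.continuous_cosh.comp (by fun_prop)).inv₀ fun _ => (Real.cosh_pos _).ne'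

theorem continuous_sech (A a y : ℝ) : Continuous (sech A a y) :=
  Complex.continuous_ofReal.comp (continuous_const.mul (continuous_inv_cosh a y))

theorem contDiff_sech (A a y : ℝ) : ContDiff ℝ 1 (sech A a y) := by
  rw [contDiff_one_iff_deriv]
  refine ⟨fun t => (hasDerivAt_sech A a y t).differentiableAt, ?_⟩
  rw [deriv_sech]
  have := continuous_inv_cosh a y
  exact Complex.continuous_ofReal.comp
    (((continuous_const.mul (Real.continuous_sinh.comp (by fun_prop))).mul (this.pow 2)).neg)

theorem memLp_sech (A a y : ℝ) (h : a = 0 → A = 0) :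
    MemLp (sech A a y) 2 (volume.restrict (Ioi (0 : ℝ))) := by
  rcases eq_or_ne a 0 with rfl | ha
  · have : sech A 0 y = 0 := by funext t; simp [sech, h rfl]
    rw [this]; exact MemLp.zero
  have hpos : 0 < |a| := abs_pos.mpr ha
  have hg : MemLp (fun t : ℝ => (|A| * 2 * Real.exp |a * y|) * Real.exp (-|a| * t)) 2
      (volume.restrict (Ioi (0 : ℝ))) := by
    refine MemLp.const_mul ?_ _
    rw [memLp_two_iff_integrable_sq (by fun_prop)]
    have := exp_neg_integrableOn_Ioi 0 (show 0 < 2 * |a| by positivity)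
    refine this.congr_fun (fun t _ => ?_) measurableSet_Ioi
    simp only [← Real.exp_nat_mul]
    congr 1; push_cast; ring
  refine hg.mono (continuous_sech A a y).aestronglyMeasurable ?_
  filter_upwards [ae_restrict_mem measurableSet_Ioi] with t ht
  have ht : 0 < t := ht
  set z := a * (t - y) with hz
  have hcosh : Real.exp |z| ≤ 2 * Real.cosh z := by
    rw [← Real.cosh_abs z, Real.cosh_eq]; linarith [Real.exp_pos (-|z|)]
  have hz' : |a| * t - |a * y| ≤ |z| := by
    have : |a * t| - |a * y| ≤ |a * t - a * y| := abs_sub_abs_le_abs_sub _ _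
    rw [abs_mul a t, abs_of_pos ht] at this
    rwa [hz, mul_sub]
  have key : (Real.cosh z)⁻¹ ≤ 2 * Real.exp |a * y| * Real.exp (-|a| * t) := by
    rw [inv_le_iff_one_le_mul₀ (Real.cosh_pos z)]
    have : Real.exp |z| * (Real.exp |a * y| * Real.exp (-|a| * t)) ≥ 1 := by
      rw [← Real.exp_add, ← Real.exp_add]
      exact Real.one_le_exp (by linarith)
    nlinarith [mul_le_mul_of_nonneg_right hcosh
      (show 0 ≤ Real.exp |a * y| * Real.exp (-|a| * t) by positivity)]
  simp only [sech, Complex.norm_real, Real.norm_eq_abs, abs_mul A, abs_mul (|A| * 2 * Real.exp |a * y|), abs_mul (|A| * 2),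
    abs_mul |A|]
  rw [← hz, abs_of_pos (inv_pos.mpr (Real.cosh_pos z)), abs_of_pos (Real.exp_pos _),
    abs_of_pos (Real.exp_pos (-|a| * t)), abs_abs (A),
    abs_of_pos (show (0 : ℝ) < 2 by norm_num)]
  calc |A| * (Real.cosh z)⁻¹ ≤ |A| * (2 * Real.exp |a * y| * Real.exp (-|a| * t)) :=
        mul_le_mul_of_nonneg_left key (abs_nonneg A)
    _ = _ := by ring

theorem memLp_deriv_sech (A a y : ℝ) (h : a = 0 → A = 0) :
    MemLp (deriv (sech A a y)) 2 (volume.restrict (Ioi (0 : ℝ))) := by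
  refine ((memLp_sech A a y h).const_mul (a : ℂ)).mono
    ((contDiff_sech A a y).continuous_deriv (by simp)).aestronglyMeasurable
    (Eventually.of_forall fun t => ?_)
  rw [deriv_sech]
  set z := a * (t - y)
  have hc := Real.cosh_pos z
  have hs : |Real.sinh z| ≤ Real.cosh z :=
    abs_le_of_sq_le_sq (by nlinarith [Real.cosh_sq z]) hc.le
  simp only [sech, norm_mul, Complex.norm_real, Real.norm_eq_abs, abs_neg, abs_mul,
    abs_pow, abs_inv]
  change |A| * |a| * |Real.sinh z| * |Real.cosh z|⁻¹ ^ 2 ≤ |a| * (|A| * |Real.cosh z|⁻¹)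
  rw [abs_of_pos hc]
  have : |Real.sinh z| * (Real.cosh z)⁻¹ ≤ 1 := by
    rw [← div_eq_mul_inv]; exact (div_le_one hc).mpr hs
  have h2 : 0 ≤ |A| * |a| * (Real.cosh z)⁻¹ := by positivity
  calc _ = |A| * |a| * (Real.cosh z)⁻¹ * (|Real.sinh z| * (Real.cosh z)⁻¹) := by ring
    _ ≤ |A| * |a| * (Real.cosh z)⁻¹ * 1 := mul_le_mul_of_nonneg_left this h2
    _ = _ := by ring

/-- The profile `t ↦ A / cosh (a (t - y))` as an element of `H¹(ℝ⁺)`. -/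
def sechH1 (A a y : ℝ) (h : a = 0 → A = 0) : H1 :=
  ofFun (sech A a y) (contDiff_sech A a y) (memLp_sech A a y h) (memLp_deriv_sech A a y h)

/-- The state `Φ` with parameters `m₁, m₂, x`: its components are
`(m₁ / √2) / cosh (m₁ t / 2)`, `(m₂ / (2 √2)) / cosh (m₂ (t - x) / 4)` and
`(m₂ / (2 √2)) / cosh (m₂ (t + x) / 4)`. -/
def sesqui (m₁ m₂ x : ℝ) : H1Graph :=
  ![sechH1 (m₁ / √2) (m₁ / 2) 0 (fun h => by
      have : m₁ = 0 := by linarith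
      simp [this]),
    sechH1 (m₂ / (2 * √2)) (m₂ / 4) x (fun h => by
      have : m₂ = 0 := by linarith
      simp [this]),
    sechH1 (m₂ / (2 * √2)) (m₂ / 4) (-x) (fun h => by
      have : m₂ = 0 := by linarith
      simp [this])]

/-- The conditions on the parameters under which `sesqui m₁ m₂ x` is a sesquisoliton. -/
def Admissible (m₁ m₂ x : ℝ) : Prop :=
  0 < m₁ ∧ m₁ ≤ m₂ ∧ 0 ≤ x ∧ m₁ = m₂ / 2 * (Real.cosh (m₂ / 4 * x))⁻¹

/-- The sesquisolitons of mass `M`. -/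
def sesquisolitons (M : ℝ) : Set H1Graph :=
  {Ψ | (∃ m₁ m₂ x, Admissible m₁ m₂ x ∧ Ψ = sesqui m₁ m₂ x) ∧ mass Ψ = M}

end StarGraph

end

noncomputable section

namespace StarGraph

/-! At `x = 0` the three components of the state coincide with one half-soliton `φ(t) = √2 a / cosh
(a t)`, `a = M/6`, of mass `2a` and edge energy `-a³/3`. It satisfies `φ'' = a²φ - φ³` and `φ'(0) =
0`. Hence Kirchhoff's condition is trivial, and integrating `dE` by parts leaves no boundary term,
whatever the variation does at the vertex (`edgeEnergyDeriv_soliton`). The Fréchet differential of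
`E` exists because the Sobolev bound makes the quartic remainder quadratic in the variation
(`abs_edgeEnergy_sub_le`).

For the symmetric minimum, let `T(t)` be the fraction of the mass of `u` in `(0, t)`. Expanding `∫
|u' + a T u|² ≥ 0` and integrating by parts gives the edge energy bound `-a³/3` at mass `2a`
(`energy_edge_ge`), attained by `φ`.

Saddle: the dilations `s φ(s² t)` keep the mass and have energy `a³ (s⁴ - 2 s²)`, minimal at `s =
1`, so the state is no local maximum. On the sesquisolitons the second and third edges together
carry one full soliton, cut at a point depending on `x`; thus mass `m₁ + m₂` and energy `-m₁³/24 -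
m₂³/96` do not involve `x`. At fixed mass the energy is strictly increasing in `m₁ ≤ M/3`
(`strictMonoOn_energy_curve`). The matching condition at the vertex determines `x ≥ 0` from `m₁`
through `arcosh`, so these states form a continuous curve ending at the given state, which therefore
is no local minimum.

Since `H1` is defined by weak derivatives, the integrations by parts rest on absolutely continuous
representatives (`HasWeakDeriv.exists_hasACDeriv`). -/

/-! ### Absolutely continuous functions on the half-line -/

/-- Lebesgue measure on the half-line `(0, ∞)`. -/
abbrev halfLine : Measure ℝ := volume.restrict (Ioi (0 : ℝ))

/-- `f` is locally absolutely continuous on `[0, ∞)`, with almost everywhere derivative `p`. -/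
structure HasACDeriv (f p : ℝ → ℝ) : Prop where
  ac : ∀ R, 0 ≤ R → AbsolutelyContinuousOnInterval f 0 R
  deriv : ∀ᵐ t ∂halfLine, HasDerivAt f (p t) t

namespace HasACDeriv

variable {f g p q : ℝ → ℝ}

theorem mul (hf : HasACDeriv f p) (hg : HasACDeriv g q) :
    HasACDeriv (fun t => f t * g t) (fun t => p t * g t + f t * q t) where
  ac R hR := (hf.ac R hR).fun_mul (hg.ac R hR)
  deriv := by filter_upwards [hf.deriv, hg.deriv] with t h1 h2 using h1.mul h2

theorem add (hf : HasACDeriv f p) (hg : HasACDeriv g q) :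
    HasACDeriv (fun t => f t + g t) (fun t => p t + q t) where
  ac R hR := (hf.ac R hR).fun_add (hg.ac R hR)
  deriv := by filter_upwards [hf.deriv, hg.deriv] with t h1 h2 using h1.add h2

theorem of_contDiff (hf : ContDiff ℝ 1 f) : HasACDeriv f (_root_.deriv f) where
  ac R _ := hf.contDiffOn.absolutelyContinuousOnInterval
  deriv := Eventually.of_forall fun t => (hf.differentiable (by simp) t).hasDerivAt

theorem primitive (hp : LocallyIntegrable p) (c : ℝ) :
    HasACDeriv (fun t => c + ∫ s in (0 : ℝ)..t, p s) p where
  ac R _ := by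
    have h : IntervalIntegrable p volume 0 R := intervalIntegrable_iff.mpr
      ((hp.integrableOn_isCompact isCompact_uIcc).mono_set uIoc_subset_uIcc)
    exact (contDiff_const.contDiffOn (n := 1)).absolutelyContinuousOnInterval.fun_add
      (h.absolutelyContinuousOnInterval_intervalIntegral left_mem_uIcc)
  deriv := by
    filter_upwards [ae_restrict_of_ae (LocallyIntegrable.ae_hasDerivAt_integral hp)] with t ht
    exact (ht 0).const_add c

theorem congr_deriv (hf : HasACDeriv f p) (h : p =ᵐ[halfLine] q) : HasACDeriv f q where
  ac := hf.ac
  deriv := by filter_upwards [hf.deriv, h] with t h1 h2 using h2 ▸ h1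

theorem integral_eq_sub (hf : HasACDeriv f p) {a b : ℝ} (ha : 0 ≤ a) (hab : a ≤ b) :
    ∫ t in a..b, p t = f b - f a := by
  have h := (hf.ac b (ha.trans hab)).mono (c := a) (d := b) (by
    rw [uIcc_of_le hab, uIcc_of_le (ha.trans hab)]; exact Icc_subset_Icc_left ha)
  rw [← h.integral_deriv_eq_sub]
  refine intervalIntegral.integral_congr_ae ?_
  filter_upwards [(ae_restrict_iff' measurableSet_Ioi).mp hf.deriv] with t ht hm
  rw [uIoc_of_le hab] at hm
  exact (ht (ha.trans_lt hm.1)).deriv.symm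

/-- The fundamental theorem of calculus on a half-line. -/
theorem integral_Ioi_eq_sub (hf : HasACDeriv f p) (hpi : Integrable p halfLine) {a l : ℝ}
    (ha : 0 ≤ a) (hl : Tendsto f atTop (𝓝 l)) : ∫ t in Ioi a, p t = l - f a := by
  have hpa : IntegrableOn p (Ioi a) := IntegrableOn.mono_set hpi (Ioi_subset_Ioi ha)
  refine tendsto_nhds_unique (intervalIntegral_tendsto_integral_Ioi a hpa tendsto_id)
    ((hl.sub_const (f a)).congr' ?_)
  filter_upwards [eventually_ge_atTop a] with b hb
  rw [id, hf.integral_eq_sub ha hb]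

/-- Integrability of the derivative makes `f` converge at infinity. A nonzero limit would contradict
integrability of `f`, because neighbourhoods of infinity have infinite measure. -/
theorem tendsto_zero (hf : HasACDeriv f p) (hfi : Integrable f halfLine)
    (hpi : Integrable p halfLine) : Tendsto f atTop (𝓝 0) := by
  have hlim : Tendsto f atTop (𝓝 (f 0 + ∫ t in Ioi 0, p t)) := by
    have h := (intervalIntegral_tendsto_integral_Ioi 0 hpi tendsto_id).const_add (f 0)
    refine h.congr' ?_
    filter_upwards [eventually_ge_atTop 0] with b hb
    rw [id, hf.integral_eq_sub le_rfl hb]; ring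
  have : IntegrableAtFilter f atTop := ⟨Ioi 0, Ioi_mem_atTop _, hfi⟩
  rwa [IntegrableAtFilter.eq_zero_of_tendsto this (fun s hs => ?_) hlim] at hlim
  rcases mem_atTop_sets.1 hs with ⟨b, hb⟩
  rw [← top_le_iff, ← Real.volume_Ici (a := b)]
  exact measure_mono hb

/-- The fundamental theorem of calculus on a half-line for an integrable absolutely continuous
function. -/
theorem integral_Ioi_eq_neg (hf : HasACDeriv f p) (hfi : Integrable f halfLine)
    (hpi : Integrable p halfLine) {a : ℝ} (ha : 0 ≤ a) : ∫ t in Ioi a, p t = -f a := by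
  rw [hf.integral_Ioi_eq_sub hpi ha (hf.tendsto_zero hfi hpi), zero_sub]

end HasACDeriv

/-! ### The lemma of du Bois-Reymond and absolutely continuous representatives -/

/-- A smooth function with compact support in the positive half-line and vanishing integral has a
primitive of the same kind. -/
theorem exists_primitive_of_integral_eq_zero {ψ : ℝ → ℝ} (hψ : ContDiff ℝ (⊤ : ℕ∞) ψ)
    (hc : HasCompactSupport ψ) (hs : tsupport ψ ⊆ Ioi 0) (h0 : ∫ t, ψ t = 0) :
    ∃ η : ℝ → ℝ, ContDiff ℝ (⊤ : ℕ∞) η ∧ HasCompactSupport η ∧ tsupport η ⊆ Ioi 0 ∧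
      deriv η = ψ := by
  have hi : Integrable ψ := hψ.continuous.integrable_of_hasCompactSupport hc
  obtain ⟨α, β, hα, hsub⟩ : ∃ α β : ℝ, 0 < α ∧ tsupport ψ ⊆ Icc α β := by
    rcases (tsupport ψ).eq_empty_or_nonempty with h | h
    · exact ⟨1, 1, one_pos, by simp [h]⟩
    · have hcc : IsCompact (tsupport ψ) := hc
      exact ⟨sInf (tsupport ψ), sSup (tsupport ψ), hs (hcc.sInf_mem h), fun t ht =>
        ⟨csInf_le hcc.bddBelow ht, le_csSup hcc.bddAbove ht⟩⟩
  have hz : ∀ t, t ∉ Icc α β → ψ t = 0 := fun t ht =>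
    image_eq_zero_of_notMem_tsupport fun h => ht (hsub h)
  set η : ℝ → ℝ := fun t => ∫ s in α..t, ψ s with hη
  have hd : ∀ t, HasDerivAt η (ψ t) t := fun t =>
    intervalIntegral.integral_hasDerivAt_right (hi.intervalIntegrable)
      (hψ.continuous.stronglyMeasurableAtFilter _ _) hψ.continuous.continuousAt
  have hder : deriv η = ψ := funext fun t => (hd t).deriv
  have hsupp : ∀ t, t ∉ Icc α β → η t = 0 := by
    intro t ht
    rcases lt_or_ge t α with h | h
    · refine (intervalIntegral.integral_congr_ae (g := fun _ => 0) ?_).trans (by simp)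
      filter_upwards [Measure.ae_ne volume α] with s hsne hsm
      refine hz s fun h' => ?_
      rw [uIoc_of_ge h.le] at hsm
      exact hsne (le_antisymm hsm.2 h'.1)
    -- To the right of the support the primitive equals the full integral of `ψ`, which vanishes.
    · have hβ : β < t := by
        by_contra h'; exact ht ⟨h, not_lt.mp h'⟩
      rw [hη]
      simp only
      rw [intervalIntegral.integral_of_le h, ← h0]
      rw [← integral_Icc_eq_integral_Ioc]
      refine setIntegral_eq_integral_of_forall_compl_eq_zero fun s hsn => hz s fun h' => hsn ?_
      exact ⟨h'.1, h'.2.trans hβ.le⟩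
  have hts : tsupport η ⊆ Icc α β := by
    refine closure_minimal (fun t ht => ?_) isClosed_Icc
    by_contra h
    exact ht (hsupp t h)
  refine ⟨η, ?_, HasCompactSupport.of_support_subset_isCompact isCompact_Icc
    (subset_closure.trans hts), hts.trans fun t ht => hα.trans_le ht.1, hder⟩
  rw [contDiff_infty_iff_deriv, hder]
  exact ⟨fun t => (hd t).differentiableAt, hψ⟩

/-- The lemma of du Bois-Reymond on the positive half-line. -/
theorem ae_eq_const_of_integral_deriv_mul_eq_zero {w : ℝ → ℝ}
    (hw : LocallyIntegrableOn w (Ioi 0))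
    (h : ∀ η : ℝ → ℝ, ContDiff ℝ (⊤ : ℕ∞) η → HasCompactSupport η → tsupport η ⊆ Ioi 0 →
      ∫ t in Ioi (0 : ℝ), deriv η t * w t = 0) :
    ∃ c : ℝ, ∀ᵐ t ∂halfLine, w t = c := by
  have hint : ∀ η : ℝ → ℝ, Continuous η → HasCompactSupport η → tsupport η ⊆ Ioi 0 →
      IntegrableOn (fun t => η t * w t) (Ioi 0) := by
    intro η h1 h2 h3
    have := (hw.integrableOn_compact_subset h3 h2).continuousOn_mul (g := η)
      (by fun_prop) h2
    refine IntegrableOn.of_forall_sdiff_eq_zero this measurableSet_Ioi fun t ht => ?_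
    rw [image_eq_zero_of_notMem_tsupport ht.2, zero_mul]
  -- Centre 2 and outer radius 1 keep the support in `[1, 3]`, away from the origin.
  let b : ContDiffBump (2 : ℝ) := ⟨1 / 2, 1, by norm_num, by norm_num⟩
  set ρ : ℝ → ℝ := b.normed volume with hρ
  have hρs : tsupport ρ ⊆ Ioi 0 := by
    rw [hρ, b.tsupport_normed_eq]
    intro t ht
    rw [Metric.mem_closedBall, Real.dist_eq] at ht
    have := (abs_le.mp ht).1
    change -1 ≤ t - 2 at this
    change 0 < t
    linarith
  have hρ1 : ContDiff ℝ (⊤ : ℕ∞) ρ := b.contDiff_normed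
  have hρ2 : HasCompactSupport ρ := b.hasCompactSupport_normed
  have hρ3 : ∫ t, ρ t = 1 := b.integral_normed
  refine ⟨∫ t in Ioi (0 : ℝ), ρ t * w t, ?_⟩
  set c := ∫ t in Ioi (0 : ℝ), ρ t * w t
  have key := isOpen_Ioi.ae_eq_zero_of_integral_contDiff_smul_eq_zero
    (U := Ioi (0 : ℝ)) (f := fun t => w t - c) (μ := volume)
    (hw.sub ((locallyIntegrable_const c).locallyIntegrableOn _)) ?_
  · rw [ae_restrict_iff' measurableSet_Ioi]
    filter_upwards [key] with t ht hm using sub_eq_zero.mp (ht hm)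
  intro ψ h1 h2 h3
  set m := ∫ t, ψ t
  have hi1 : Integrable ψ := h1.continuous.integrable_of_hasCompactSupport h2
  have hi2 : Integrable ρ := hρ1.continuous.integrable_of_hasCompactSupport hρ2
  -- Subtracting `m ρ` makes the mean zero, so `ψ - m ρ` is the derivative of a test function and
  -- `w` annihilates it. This gives `∫ ψ w = m c = ∫ ψ c`.
  have hs : tsupport (fun t => ψ t - m * ρ t) ⊆ Ioi 0 := by
    refine (tsupport_sub ψ (fun t => m * ρ t)).trans (union_subset h3 ?_)
    exact (tsupport_mul_subset_right (f := fun _ => m) (g := ρ)).trans hρs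
  obtain ⟨η, e1, e2, e3, e4⟩ := exists_primitive_of_integral_eq_zero
    (ψ := fun t => ψ t - m * ρ t) (h1.sub (contDiff_const.mul hρ1))
    (h2.sub (hρ2.mul_left (f := fun _ => m))) hs (by
      rw [integral_sub hi1 (hi2.const_mul m), integral_const_mul, hρ3, mul_one, sub_self])
  have e5 := h η e1 e2 e3
  rw [e4] at e5
  have i1 := hint ψ h1.continuous h2 h3
  have i2 := hint ρ hρ1.continuous hρ2 hρs
  have e6 : ∫ t in Ioi (0 : ℝ), ψ t * w t = m * c := by
    have : ∫ t in Ioi (0 : ℝ), (ψ t * w t - m * (ρ t * w t)) = 0 :=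
      (integral_congr_ae (Eventually.of_forall fun t => by ring)).trans e5
    rw [integral_sub i1 (i2.const_mul m), integral_const_mul] at this
    linarith
  have e7 : ∫ t in Ioi (0 : ℝ), ψ t = m :=
    setIntegral_eq_integral_of_forall_compl_eq_zero fun t ht =>
      image_eq_zero_of_notMem_tsupport fun h => ht (h3 h)
  rw [← setIntegral_eq_integral_of_forall_compl_eq_zero (s := Ioi (0 : ℝ))]
  · have : ∫ t in Ioi (0 : ℝ), (ψ t * w t - ψ t * c) = 0 := by
      rw [integral_sub i1 (hi1.integrableOn.mul_const c), integral_mul_const, e6, e7, sub_self]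
    exact (integral_congr_ae (Eventually.of_forall fun t => by
      simp only [smul_eq_mul]; ring)).trans this
  · intro t ht
    rw [image_eq_zero_of_notMem_tsupport fun h => ht (h3 h), zero_smul]

theorem locallyIntegrable_indicator {p : ℝ → ℝ} (hp : LocallyIntegrable p halfLine) :
    LocallyIntegrable ((Ioi 0).indicator p) := by
  rw [locallyIntegrable_iff]
  intro K hK
  have h := hp.integrableOn_isCompact hK
  rw [IntegrableOn, Measure.restrict_restrict hK.measurableSet] at h
  rw [IntegrableOn, integrable_indicator_iff measurableSet_Ioi, IntegrableOn,
    Measure.restrict_restrict measurableSet_Ioi, inter_comm]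
  exact h

/-- Only the restriction of `p` to the half-line is controlled; extension by zero gives a primitive
that is defined and continuous on all of `ℝ`. -/
theorem HasACDeriv.primitive_indicator {p : ℝ → ℝ} (hp : LocallyIntegrable p halfLine) (c : ℝ) :
    HasACDeriv (fun t => c + ∫ s in (0 : ℝ)..t, (Ioi 0).indicator p s) p :=
  (HasACDeriv.primitive (locallyIntegrable_indicator hp) c).congr_deriv (by
    filter_upwards [ae_restrict_mem measurableSet_Ioi] with t ht using indicator_of_mem ht p)

theorem continuous_primitive_indicator {p : ℝ → ℝ} (hp : LocallyIntegrable p halfLine) :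
    Continuous (fun t => ∫ s in (0 : ℝ)..t, (Ioi 0).indicator p s) :=
  intervalIntegral.continuous_primitive (fun _ _ => intervalIntegrable_iff.mpr
      (((locallyIntegrable_indicator hp).integrableOn_isCompact isCompact_uIcc).mono_set
        uIoc_subset_uIcc)) 0

theorem L2.locallyIntegrable (u : L2) : LocallyIntegrable u halfLine :=
  (Lp.memLp u).locallyIntegrable (by norm_num)

/-- A real part of an element of `H¹(ℝ⁺)` has a locally absolutely continuous representative. -/
theorem HasWeakDeriv.exists_hasACDeriv {u v : L2} (h : HasWeakDeriv u v) (φ : ℂ →L[ℝ] ℝ) :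
    ∃ f : ℝ → ℝ, HasACDeriv f (fun t => φ (v t)) ∧ ∀ᵐ t ∂halfLine, φ (u t) = f t := by
  have hloc : ∀ w : L2, LocallyIntegrable (fun t => φ (w t)) halfLine := fun w => by
    rw [locallyIntegrable_iff]
    intro K hK
    exact φ.integrable_comp ((L2.locallyIntegrable w).integrableOn_isCompact hK)
  set V : ℝ → ℝ := fun t => ∫ s in (0 : ℝ)..t, (Ioi 0).indicator (fun t => φ (v t)) s
  have hVc : Continuous V := continuous_primitive_indicator (hloc v)
  have hV : HasACDeriv V (fun t => φ (v t)) := by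
    simpa using HasACDeriv.primitive_indicator (hloc v) 0
  have hw : LocallyIntegrableOn (fun t => φ (u t) - V t) (Ioi 0) :=
    (locallyIntegrableOn_of_locallyIntegrable_restrict (hloc u)).sub
      (hVc.locallyIntegrable.locallyIntegrableOn _)
  -- `φ ∘ u` and the primitive `V` of `φ ∘ v` have the same weak derivative, so they differ by a
  -- constant.
  obtain ⟨c, hc⟩ := ae_eq_const_of_integral_deriv_mul_eq_zero hw (by
    intro η h1 h2 h3
    have hη' : Continuous (deriv η) := h1.continuous_deriv (by simp)
    have i1 := integrable_test_smul hη' h2.deriv u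
    have i2 := integrable_test_smul h1.continuous h2 v
    have e1 := congrArg φ (h η h1 h2 h3)
    rw [map_neg, ← φ.integral_comp_comm i1, ← φ.integral_comp_comm i2] at e1
    simp only [map_smul, smul_eq_mul] at e1
    have j1 : Integrable (fun t => deriv η t * φ (u t)) halfLine := by
      refine (φ.integrable_comp i1).congr (Eventually.of_forall fun t => ?_)
      simp only [map_smul, smul_eq_mul]
    have j2 : Integrable (fun t => η t * φ (v t)) halfLine := by
      refine (φ.integrable_comp i2).congr (Eventually.of_forall fun t => ?_)
      simp only [map_smul, smul_eq_mul]
    have j3 : Integrable (fun t => deriv η t * V t) halfLine :=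
      ((hη'.mul hVc).integrable_of_hasCompactSupport h2.deriv.mul_right).restrict
    have j4 : Integrable (fun t => η t * V t) halfLine :=
      ((h1.continuous.mul hVc).integrable_of_hasCompactSupport h2.mul_right).restrict
    have e2 := ((HasACDeriv.of_contDiff (h1.of_le (by simp))).mul hV).integral_Ioi_eq_neg
      j4 (j3.add j2) le_rfl
    rw [integral_add j3 j2, image_eq_zero_of_notMem_tsupport (fun h' => lt_irrefl (0 : ℝ) (h3 h')),
      zero_mul, neg_zero] at e2
    simp only [mul_sub]
    rw [integral_sub j1 j3, e1]
    linarith)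
  refine ⟨fun t => c + V t, HasACDeriv.primitive_indicator (hloc v) c, ?_⟩
  filter_upwards [hc] with t ht
  linarith

/-! ### Square integrals and the Sobolev bound -/

theorem integrable_norm_sq (u : L2) : Integrable (fun t => ‖u t‖ ^ 2) halfLine :=
  (Lp.memLp u).integrable_norm_pow (by norm_num)

theorem L2.re_inner_eq_integral (u v : L2) :
    (inner ℂ u v : ℂ).re = ∫ t in Ioi (0 : ℝ), ((u t).re * (v t).re + (u t).im * (v t).im) := by
  rw [L2.inner_def]
  refine (integral_re (𝕜 := ℂ) (L2.integrable_inner u v)).symm.trans ?_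
  refine integral_congr_ae (Eventually.of_forall fun t => ?_)
  simp [mul_comm]

theorem L2.norm_sq_eq_integral (u : L2) : ‖u‖ ^ 2 = ∫ t in Ioi (0 : ℝ), ‖u t‖ ^ 2 := by
  refine ((inner_self_eq_norm_sq (𝕜 := ℂ) u).symm.trans (L2.re_inner_eq_integral u u)).trans ?_
  refine integral_congr_ae (Eventually.of_forall fun t => ?_)
  simp only [← Complex.normSq_eq_norm_sq, Complex.normSq_apply]

theorem L2.integrable_re_inner (u v : L2) :
    Integrable (fun t => (u t).re * (v t).re + (u t).im * (v t).im) halfLine := by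
  refine (L2.integrable_inner (𝕜 := ℂ) u v).re.congr (Eventually.of_forall fun t => ?_)
  simp [mul_comm]

/-- The squared modulus of an element of `H¹(ℝ⁺)` is absolutely continuous. -/
theorem exists_hasACDeriv_norm_sq (p : H1) :
    ∃ N : ℝ → ℝ, HasACDeriv N (fun t => 2 * ((p.1.1 t).re * (p.1.2 t).re
      + (p.1.1 t).im * (p.1.2 t).im)) ∧ ∀ᵐ t ∂halfLine, ‖p.1.1 t‖ ^ 2 = N t := by
  obtain ⟨f, hf, hfu⟩ := HasWeakDeriv.exists_hasACDeriv p.2 Complex.reCLM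
  obtain ⟨g, hg, hgu⟩ := HasWeakDeriv.exists_hasACDeriv p.2 Complex.imCLM
  refine ⟨_, ((hf.mul hf).add (hg.mul hg)).congr_deriv ?_, ?_⟩
  · filter_upwards [hfu, hgu] with t h1 h2
    simp only [← h1, ← h2, Complex.reCLM_apply, Complex.imCLM_apply]
    ring
  · filter_upwards [hfu, hgu] with t h1 h2
    rw [← h1, ← h2, ← Complex.normSq_eq_norm_sq, Complex.normSq_apply]
    simp

theorem norm_comp_le (p : H1) : ‖p.1.1‖ ≤ ‖p‖ := norm_fst_le p.1

theorem norm_dcomp_le (p : H1) : ‖p.1.2‖ ≤ ‖p‖ := norm_snd_le p.1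

/-- The Sobolev embedding `H¹(ℝ⁺) ⊆ L∞`, for the continuous representative of `|u|²`. -/
theorem HasACDeriv.norm_sq_le {p : H1} {N : ℝ → ℝ}
    (hN : HasACDeriv N (fun t => 2 * ((p.1.1 t).re * (p.1.2 t).re
      + (p.1.1 t).im * (p.1.2 t).im))) (hNu : ∀ᵐ t ∂halfLine, ‖p.1.1 t‖ ^ 2 = N t)
    {t : ℝ} (ht : 0 ≤ t) : N t ≤ 2 * ‖p‖ ^ 2 := by
  have h := hN.integral_Ioi_eq_neg ((integrable_norm_sq p.1.1).congr hNu)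
    ((L2.integrable_re_inner p.1.1 p.1.2).const_mul 2) ht
  have hi : Integrable (fun s => ‖p.1.1 s‖ ^ 2 + ‖p.1.2 s‖ ^ 2) halfLine :=
    (integrable_norm_sq _).add (integrable_norm_sq _)
  -- This is `-2 Re (ū u') ≤ |u|² + |u'|²`. The norm of `H1` is the larger of the two `L²` norms,
  -- whence the factor 2 in the final bound.
  have h2 : -∫ s in Ioi t, 2 * ((p.1.1 s).re * (p.1.2 s).re + (p.1.1 s).im * (p.1.2 s).im)
      ≤ ∫ s in Ioi t, (‖p.1.1 s‖ ^ 2 + ‖p.1.2 s‖ ^ 2) := by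
    rw [← integral_neg]
    refine integral_mono (IntegrableOn.mono_set ((L2.integrable_re_inner p.1.1 p.1.2).const_mul 2).neg
      (Ioi_subset_Ioi ht)) (IntegrableOn.mono_set hi (Ioi_subset_Ioi ht)) fun s => ?_
    rw [← Complex.normSq_eq_norm_sq, ← Complex.normSq_eq_norm_sq, Complex.normSq_apply,
      Complex.normSq_apply]
    simp only
    nlinarith [sq_nonneg ((p.1.1 s).re + (p.1.2 s).re), sq_nonneg ((p.1.1 s).im + (p.1.2 s).im)]
  have h3 : ∫ s in Ioi t, (‖p.1.1 s‖ ^ 2 + ‖p.1.2 s‖ ^ 2)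
      ≤ ∫ s in Ioi (0 : ℝ), (‖p.1.1 s‖ ^ 2 + ‖p.1.2 s‖ ^ 2) :=
    setIntegral_mono_set hi (Eventually.of_forall fun s => by positivity)
      (Ioi_subset_Ioi ht).eventuallyLE
  rw [integral_add (integrable_norm_sq _) (integrable_norm_sq _), ← L2.norm_sq_eq_integral,
    ← L2.norm_sq_eq_integral] at h3
  have h4 := pow_le_pow_left₀ (norm_nonneg _) (norm_comp_le p) 2
  have h5 := pow_le_pow_left₀ (norm_nonneg _) (norm_dcomp_le p) 2
  linarith

theorem ae_norm_sq_le (p : H1) : ∀ᵐ t ∂halfLine, ‖p.1.1 t‖ ^ 2 ≤ 2 * ‖p‖ ^ 2 := by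
  obtain ⟨N, hN, hNu⟩ := exists_hasACDeriv_norm_sq p
  filter_upwards [hNu, ae_restrict_mem measurableSet_Ioi] with t h1 ht
  rw [h1]
  exact hN.norm_sq_le hNu (le_of_lt ht)

theorem integrable_norm_pow_four (p : H1) : Integrable (fun t => ‖p.1.1 t‖ ^ 4) halfLine := by
  refine ((integrable_norm_sq p.1.1).const_mul (2 * ‖p‖ ^ 2)).mono'
    ((Lp.aestronglyMeasurable p.1.1).norm.pow 4) ?_
  filter_upwards [ae_norm_sq_le p] with t ht
  rw [Real.norm_of_nonneg (by positivity)]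
  calc ‖p.1.1 t‖ ^ 4 = ‖p.1.1 t‖ ^ 2 * ‖p.1.1 t‖ ^ 2 := by ring
    _ ≤ _ := by gcongr

/-! ### Sharp energy bound on one edge -/

/-- The sharp lower bound for the energy on a half-line at fixed mass. -/
theorem energy_edge_ge (p : H1) {a : ℝ} (ha : 0 < a) (hm : ‖p.1.1‖ ^ 2 = 2 * a) :
    -(a ^ 3 / 3) ≤ 1 / 2 * ‖p.1.2‖ ^ 2 - 1 / 4 * ∫ t in Ioi (0 : ℝ), ‖p.1.1 t‖ ^ 4 := by
  obtain ⟨N, hN, hNu⟩ := exists_hasACDeriv_norm_sq p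
  set q : ℝ → ℝ := fun t => 2 * ((p.1.1 t).re * (p.1.2 t).re + (p.1.1 t).im * (p.1.2 t).im)
  set n : ℝ → ℝ := fun t => ‖p.1.1 t‖ ^ 2
  have hni : Integrable n halfLine := integrable_norm_sq p.1.1
  have hqi : Integrable q halfLine := (L2.integrable_re_inner p.1.1 p.1.2).const_mul 2
  have hn' : Integrable (fun t => (2 * a)⁻¹ * n t) halfLine := hni.const_mul _
  have hn0 : ∀ t, 0 ≤ (2 * a)⁻¹ * n t := fun t => by positivity
  have hnint : ∫ t in Ioi (0 : ℝ), (2 * a)⁻¹ * n t = 1 := by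
    rw [integral_const_mul, ← L2.norm_sq_eq_integral, hm, inv_mul_cancel₀ (by positivity)]
  -- `T` is the fraction of the mass in `(0, t)`. For the half-soliton it is `tanh (a t)`, and `u' =
  -- -a T u`; this suggests the square integrated in `e3`.
  set T : ℝ → ℝ := fun t => ∫ s in (0 : ℝ)..t, (Ioi 0).indicator (fun t => (2 * a)⁻¹ * n t) s
  have hTc : Continuous T := continuous_primitive_indicator hn'.locallyIntegrable
  have hT : HasACDeriv T (fun t => (2 * a)⁻¹ * n t) := by
    simpa only [zero_add] using HasACDeriv.primitive_indicator hn'.locallyIntegrable 0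
  have hTeq : ∀ t, 0 ≤ t → T t = ∫ s in (0 : ℝ)..t, (2 * a)⁻¹ * n s := fun t ht => by
    rw [hT.integral_eq_sub le_rfl ht]; simp [T]
  have hT0 : T 0 = 0 := by simp [T]
  have hT1 : Tendsto T atTop (𝓝 1) := by
    rw [← hnint]
    refine (intervalIntegral_tendsto_integral_Ioi 0 hn' tendsto_id).congr' ?_
    filter_upwards [eventually_ge_atTop 0] with t ht using (hTeq t ht).symm
  have hTb : ∀ᵐ t ∂halfLine, ‖T t‖ ≤ 1 := by
    filter_upwards [ae_restrict_mem measurableSet_Ioi] with t ht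
    have ht : 0 < t := ht
    rw [hTeq t ht.le, intervalIntegral.integral_of_le ht.le, Real.norm_of_nonneg
      (integral_nonneg hn0), ← hnint]
    exact setIntegral_mono_set hn' (Eventually.of_forall hn0)
      Ioc_subset_Ioi_self.eventuallyLE
  have hTm := hTc.aestronglyMeasurable (μ := halfLine)
  have i4 : Integrable (fun t => ‖p.1.1 t‖ ^ 4) halfLine := integrable_norm_pow_four p
  have iTq : Integrable (fun t => T t * q t) halfLine := hqi.bdd_mul hTm hTb
  have iTN : Integrable (fun t => T t * N t) halfLine := (hni.congr hNu).bdd_mul hTm hTb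
  have iTTn : Integrable (fun t => T t * (T t * n t)) halfLine :=
    (hni.bdd_mul hTm hTb).bdd_mul hTm hTb
  -- Integration of `(T |u|²)'`: both boundary terms vanish, since `T 0 = 0` and `T |u|²` decays.
  have e1 : (2 * a)⁻¹ * (∫ t in Ioi (0 : ℝ), ‖p.1.1 t‖ ^ 4) + ∫ t in Ioi (0 : ℝ), T t * q t = 0 := by
    have hd := (hT.mul hN).congr_deriv (q := fun t => (2 * a)⁻¹ * ‖p.1.1 t‖ ^ 4 + T t * q t) (by
      filter_upwards [hNu] with t ht
      rw [← ht]; simp only [n]; ring)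
    have := hd.integral_Ioi_eq_neg iTN ((i4.const_mul _).add iTq) le_rfl
    rw [integral_add (i4.const_mul _) iTq, integral_const_mul, hT0] at this
    linarith
  -- `T³` grows from 0 to 1 and has derivative `3 T² T'`, with `T' = |u|² / (2a)`.
  have e2 : ∫ t in Ioi (0 : ℝ), T t * (T t * n t) = 2 * a / 3 := by
    have hd := ((hT.mul (hT.mul hT))).congr_deriv
      (q := fun t => 3 * (2 * a)⁻¹ * (T t * (T t * n t)))
      (Eventually.of_forall fun t => by simp only; ring)
    have := hd.integral_Ioi_eq_sub (iTTn.const_mul _) le_rfl (hT1.mul (hT1.mul hT1))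
    rw [integral_const_mul, hT0] at this
    generalize ∫ t in Ioi (0 : ℝ), T t * (T t * n t) = I at this ⊢
    field_simp at this
    linarith
  -- The integrand is `|u' + a T u|²`.
  have e3 : 0 ≤ ∫ t in Ioi (0 : ℝ),
      (‖p.1.2 t‖ ^ 2 + a * (T t * q t) + a ^ 2 * (T t * (T t * n t))) := by
    refine integral_nonneg fun t => ?_
    simp only [n, q, ← Complex.normSq_eq_norm_sq, Complex.normSq_apply, Pi.zero_apply]
    nlinarith [sq_nonneg ((p.1.2 t).re + a * T t * (p.1.1 t).re),
      sq_nonneg ((p.1.2 t).im + a * T t * (p.1.1 t).im)]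
  have i5 : Integrable (fun t => ‖p.1.2 t‖ ^ 2 + a * (T t * q t)) halfLine :=
    (integrable_norm_sq _).add (iTq.const_mul _)
  rw [integral_add i5 (iTTn.const_mul _),
    integral_add (integrable_norm_sq _) (iTq.const_mul _), integral_const_mul,
    integral_const_mul, e2, ← L2.norm_sq_eq_integral] at e3
  have e4 : ∫ t in Ioi (0 : ℝ), T t * q t = -((2 * a)⁻¹ * ∫ t in Ioi (0 : ℝ), ‖p.1.1 t‖ ^ 4) := by
    linarith
  have e5 : a * ((2 * a)⁻¹ * ∫ t in Ioi (0 : ℝ), ‖p.1.1 t‖ ^ 4)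
      = 1 / 2 * ∫ t in Ioi (0 : ℝ), ‖p.1.1 t‖ ^ 4 := by
    field_simp
  rw [e4, mul_neg, e5] at e3
  linarith [show a ^ 2 * (2 * a / 3) = 2 * (a ^ 3 / 3) by ring]

/-! ### Fréchet differentiability of the energy -/

/-- Square integrability of `|u|² u` lets the quartic part of the differential be an `L²` product,
and hence be continuous. -/
theorem memLp_cubic (p : H1) : MemLp (fun t => (‖p.1.1 t‖ ^ 2 : ℝ) • p.1.1 t) 2 halfLine := by
  refine ((Lp.memLp p.1.1).norm.const_mul (2 * ‖p‖ ^ 2)).mono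
    (((Lp.aestronglyMeasurable p.1.1).norm.pow 2).smul (Lp.aestronglyMeasurable p.1.1)) ?_
  filter_upwards [ae_norm_sq_le p] with t ht
  rw [norm_smul, norm_mul, norm_norm, Real.norm_of_nonneg (by positivity),
    Real.norm_of_nonneg (by positivity)]
  gcongr

/-- With `A = |z|²`, `C = |w|²` and `b = Re (z̄ w)` the remainder is `4b² + 4bC + C² + 2AC`,
controlled by Cauchy-Schwarz, `b² ≤ AC`. -/
theorem abs_quartic_remainder_le (z w : ℂ) :
    |‖z + w‖ ^ 4 - ‖z‖ ^ 4 - 4 * (‖z‖ ^ 2 * (z.re * w.re + z.im * w.im))|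
      ≤ 8 * ‖z‖ ^ 2 * ‖w‖ ^ 2 + 3 * ‖w‖ ^ 4 := by
  have e1 : ‖z + w‖ ^ 2 = ‖z‖ ^ 2 + 2 * (z.re * w.re + z.im * w.im) + ‖w‖ ^ 2 := by
    simp only [← Complex.normSq_eq_norm_sq, Complex.normSq_apply, Complex.add_re, Complex.add_im]
    ring
  have e2 : (z.re * w.re + z.im * w.im) ^ 2 ≤ ‖z‖ ^ 2 * ‖w‖ ^ 2 := by
    simp only [← Complex.normSq_eq_norm_sq, Complex.normSq_apply]
    nlinarith [sq_nonneg (z.re * w.im - z.im * w.re)]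
  have h4 : ∀ x : ℂ, ‖x‖ ^ 4 = (‖x‖ ^ 2) ^ 2 := fun x => by ring
  rw [h4 (z + w), h4 z, h4 w, e1]
  set b := z.re * w.re + z.im * w.im
  have hA : 0 ≤ ‖z‖ ^ 2 := by positivity
  have hC : 0 ≤ ‖w‖ ^ 2 := by positivity
  generalize ‖z‖ ^ 2 = A at *
  generalize ‖w‖ ^ 2 = C at *
  rw [abs_le]
  constructor <;> nlinarith [sq_nonneg (b + C), sq_nonneg (b - C), mul_nonneg hA hC]

/-- The energy of a single edge. -/
def edgeEnergy (p : H1) : ℝ :=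
  1 / 2 * ‖p.1.2‖ ^ 2 - 1 / 4 * ∫ t in Ioi (0 : ℝ), ‖p.1.1 t‖ ^ 4

theorem energy_eq_sum (Ψ : H1Graph) : energy Ψ = ∑ i, edgeEnergy (Ψ i) := rfl

/-- The differential of the energy of a single edge. -/
def edgeEnergyDeriv (p : H1) : H1 →L[ℝ] ℝ :=
  (Complex.reCLM.comp (((innerSL ℂ p.1.2).comp
    ((ContinuousLinearMap.snd ℂ L2 L2).comp H1.subtypeL)).restrictScalars ℝ)) -
  (Complex.reCLM.comp (((innerSL ℂ ((memLp_cubic p).toLp _)).comp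
    ((ContinuousLinearMap.fst ℂ L2 L2).comp H1.subtypeL)).restrictScalars ℝ))

theorem integrable_cubic_mul (p h : H1) : Integrable (fun t => ‖p.1.1 t‖ ^ 2
      * ((p.1.1 t).re * (h.1.1 t).re + (p.1.1 t).im * (h.1.1 t).im)) halfLine := by
  refine (L2.integrable_re_inner p.1.1 h.1.1).bdd_mul (c := 2 * ‖p‖ ^ 2)
    ((Lp.aestronglyMeasurable p.1.1).norm.pow 2) ?_
  filter_upwards [ae_norm_sq_le p] with t ht
  rwa [Real.norm_of_nonneg (by positivity)]

theorem edgeEnergyDeriv_apply (p h : H1) : edgeEnergyDeriv p h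
    = (∫ t in Ioi (0 : ℝ), ((p.1.2 t).re * (h.1.2 t).re + (p.1.2 t).im * (h.1.2 t).im))
      - ∫ t in Ioi (0 : ℝ), ‖p.1.1 t‖ ^ 2
        * ((p.1.1 t).re * (h.1.1 t).re + (p.1.1 t).im * (h.1.1 t).im) := by
  change (inner ℂ p.1.2 h.1.2 : ℂ).re - (inner ℂ ((memLp_cubic p).toLp _) h.1.1 : ℂ).re = _
  rw [L2.re_inner_eq_integral, L2.re_inner_eq_integral]
  congr 1
  refine integral_congr_ae ?_
  filter_upwards [(memLp_cubic p).coeFn_toLp] with t ht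
  rw [ht, Complex.smul_re, Complex.smul_im]
  simp only [smul_eq_mul]
  ring

theorem abs_edgeEnergy_sub_le (p h : H1) :
    |edgeEnergy (p + h) - edgeEnergy p - edgeEnergyDeriv p h|
      ≤ (1 / 2 + 4 * ‖p‖ ^ 2 + 3 / 2 * ‖h‖ ^ 2) * ‖h‖ ^ 2 := by
  have e1 : ‖(p + h).1.2‖ ^ 2 = ‖p.1.2‖ ^ 2 + 2 * (inner ℂ p.1.2 h.1.2 : ℂ).re + ‖h.1.2‖ ^ 2 :=
    norm_add_sq (𝕜 := ℂ) p.1.2 h.1.2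
  have i0 := integrable_cubic_mul p h
  have i1 : Integrable (fun t => ‖(p + h).1.1 t‖ ^ 4 - ‖p.1.1 t‖ ^ 4) halfLine :=
    (integrable_norm_pow_four _).sub (integrable_norm_pow_four _)
  have e2 : edgeEnergy (p + h) - edgeEnergy p - edgeEnergyDeriv p h = 1 / 2 * ‖h.1.2‖ ^ 2
      - 1 / 4 * ∫ t in Ioi (0 : ℝ), (‖(p + h).1.1 t‖ ^ 4 - ‖p.1.1 t‖ ^ 4 - 4 * (‖p.1.1 t‖ ^ 2
      * ((p.1.1 t).re * (h.1.1 t).re + (p.1.1 t).im * (h.1.1 t).im))) := by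
    rw [integral_sub i1 (i0.const_mul 4), integral_sub (integrable_norm_pow_four _) (integrable_norm_pow_four _),
      integral_const_mul, edgeEnergyDeriv_apply, edgeEnergy, edgeEnergy, e1,
      L2.re_inner_eq_integral]
    ring
  -- The constants 8 and 3 of the pointwise remainder are doubled by the Sobolev bound `|u|² ≤ 2
  -- ‖u‖²`.
  have e3 : |∫ t in Ioi (0 : ℝ), (‖(p + h).1.1 t‖ ^ 4 - ‖p.1.1 t‖ ^ 4 - 4 * (‖p.1.1 t‖ ^ 2
      * ((p.1.1 t).re * (h.1.1 t).re + (p.1.1 t).im * (h.1.1 t).im)))|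
      ≤ ∫ t in Ioi (0 : ℝ), (16 * ‖p‖ ^ 2 + 6 * ‖h‖ ^ 2) * ‖h.1.1 t‖ ^ 2 := by
    rw [← Real.norm_eq_abs]
    refine norm_integral_le_of_norm_le ((integrable_norm_sq h.1.1).const_mul _) ?_
    filter_upwards [ae_norm_sq_le p, ae_norm_sq_le h, Lp.coeFn_add p.1.1 h.1.1] with t h1 h2 h3
    have h4 : (p + h).1.1 t = p.1.1 t + h.1.1 t := h3
    rw [h4, Real.norm_eq_abs]
    refine (abs_quartic_remainder_le _ _).trans ?_
    nlinarith [mul_le_mul_of_nonneg_right h1 (sq_nonneg ‖h.1.1 t‖),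
      mul_le_mul_of_nonneg_right h2 (sq_nonneg ‖h.1.1 t‖)]
  rw [integral_const_mul, ← L2.norm_sq_eq_integral] at e3
  have h4 := pow_le_pow_left₀ (norm_nonneg _) (norm_comp_le h) 2
  have h5 := pow_le_pow_left₀ (norm_nonneg _) (norm_dcomp_le h) 2
  have h6 : (16 * ‖p‖ ^ 2 + 6 * ‖h‖ ^ 2) * ‖h.1.1‖ ^ 2
      ≤ (16 * ‖p‖ ^ 2 + 6 * ‖h‖ ^ 2) * ‖h‖ ^ 2 := by gcongr
  have h7 := abs_le.mp (e3.trans h6)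
  rw [e2, abs_le]
  have h8 : 0 ≤ ‖h.1.2‖ ^ 2 := by positivity
  constructor <;> nlinarith

theorem hasFDerivAt_edgeEnergy (p : H1) : HasFDerivAt edgeEnergy (edgeEnergyDeriv p) p := by
  rw [hasFDerivAt_iff_isLittleO_nhds_zero]
  refine Asymptotics.IsBigO.trans_isLittleO (g := fun h : H1 => ‖h‖ ^ 2) ?_
    (Asymptotics.isLittleO_norm_pow_id one_lt_two)
  refine Asymptotics.IsBigO.of_bound (1 / 2 + 4 * ‖p‖ ^ 2 + 3 / 2) ?_
  filter_upwards [Metric.ball_mem_nhds (0 : H1) one_pos] with h hh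
  rw [mem_ball_zero_iff] at hh
  have : ‖h‖ ^ 2 ≤ 1 := pow_le_one₀ (norm_nonneg _) hh.le
  rw [Real.norm_eq_abs, Real.norm_of_nonneg (by positivity : 0 ≤ ‖h‖ ^ 2)]
  refine (abs_edgeEnergy_sub_le p h).trans ?_
  gcongr
  linarith

/-- The differential of the energy. -/
def energyDeriv (Ψ : H1Graph) : H1Graph →L[ℝ] ℝ :=
  ∑ i, (edgeEnergyDeriv (Ψ i)).comp (ContinuousLinearMap.proj i)

theorem hasFDerivAt_energy (Ψ : H1Graph) : HasFDerivAt energy (energyDeriv Ψ) Ψ := by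
  rw [funext energy_eq_sum]
  refine HasFDerivAt.fun_sum fun i _ => ?_
  exact (hasFDerivAt_edgeEnergy (Ψ i)).comp Ψ
    (ContinuousLinearMap.proj (R := ℝ) (φ := fun _ : Fin 3 => H1) i).hasFDerivAt

theorem energyDeriv_apply (Ψ h : H1Graph) :
    energyDeriv Ψ h = ∑ i, edgeEnergyDeriv (Ψ i) (h i) := by
  simp [energyDeriv]

/-! ### Masses and energies of the profiles, through primitives in `tanh` -/

theorem hasDerivAt_tanh_affine (a y t : ℝ) :
    HasDerivAt (fun t : ℝ => Real.tanh (a * (t - y))) (a * (1 - Real.tanh (a * (t - y)) ^ 2)) t := by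
  have h1 : HasDerivAt (fun t : ℝ => a * (t - y)) a t := by
    simpa using ((hasDerivAt_id t).sub_const y).const_mul a
  have hc := (Real.cosh_pos (a * (t - y))).ne'
  simp only [Real.tanh_eq_sinh_div_cosh]
  refine (h1.sinh.div h1.cosh hc).congr_deriv ?_
  field_simp

theorem tendsto_tanh_affine {a : ℝ} (ha : 0 < a) (y : ℝ) :
    Tendsto (fun t : ℝ => Real.tanh (a * (t - y))) atTop (𝓝 1) := by
  have h0 : ∀ x : ℝ, Real.tanh x = 1 - 2 / (Real.exp (2 * x) + 1) := fun x => by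
    have h1 : Real.exp x * Real.exp (-x) = 1 := by rw [← Real.exp_add]; simp
    have h2 : Real.exp (2 * x) = Real.exp x * Real.exp x := by rw [← Real.exp_add]; ring_nf
    have := Real.exp_pos x
    have := Real.exp_pos (-x)
    rw [Real.tanh_eq, h2, div_eq_iff (by positivity)]
    field_simp
    nlinarith
  have h1 : Tendsto (fun x : ℝ => Real.tanh x) atTop (𝓝 1) := by
    simp only [h0]
    have h2 : Tendsto (fun x : ℝ => Real.exp (2 * x) + 1) atTop atTop :=
      tendsto_atTop_add_const_right _ _ (Real.tendsto_exp_atTop.comp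
        (tendsto_id.const_mul_atTop two_pos))
    simpa using (h2.const_div_atTop 2).const_sub 1
  refine h1.comp (Tendsto.const_mul_atTop ha ?_)
  simpa [sub_eq_add_neg] using tendsto_atTop_add_const_right atTop (-y) tendsto_id

theorem inv_cosh_sq (z : ℝ) : (Real.cosh z)⁻¹ ^ 2 = 1 - Real.tanh z ^ 2 := by
  have hc := (Real.cosh_pos z).ne'
  rw [Real.tanh_eq_sinh_div_cosh, div_pow, Real.sinh_sq]
  field_simp
  ring

theorem tanh_sq_le_one (z : ℝ) : Real.tanh z ^ 2 ≤ 1 := by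
  have := inv_cosh_sq z
  nlinarith [sq_nonneg (Real.cosh z)⁻¹]

theorem norm_sech_sq (A a y t : ℝ) :
    ‖sech A a y t‖ ^ 2 = A ^ 2 * (1 - Real.tanh (a * (t - y)) ^ 2) := by
  rw [sech, Complex.norm_real, Real.norm_eq_abs, sq_abs, mul_pow, inv_cosh_sq]

theorem norm_deriv_sech_sq (A a y t : ℝ) : ‖deriv (sech A a y) t‖ ^ 2
    = A ^ 2 * a ^ 2 * (Real.tanh (a * (t - y)) ^ 2 * (1 - Real.tanh (a * (t - y)) ^ 2)) := by
  rw [deriv_sech, Complex.norm_real, Real.norm_eq_abs, sq_abs, ← inv_cosh_sq,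
    Real.tanh_eq_sinh_div_cosh]
  ring

theorem coeFn_sechH1 (A a y : ℝ) (h : a = 0 → A = 0) :
    (sechH1 A a y h).1.1 =ᵐ[halfLine] sech A a y :=
  (memLp_sech A a y h).coeFn_toLp

theorem coeFn_deriv_sechH1 (A a y : ℝ) (h : a = 0 → A = 0) :
    (sechH1 A a y h).1.2 =ᵐ[halfLine] deriv (sech A a y) :=
  (memLp_deriv_sech A a y h).coeFn_toLp

theorem norm_sq_sechH1 {A a y : ℝ} (ha : 0 < a) (h : a = 0 → A = 0) :
    ‖(sechH1 A a y h).1.1‖ ^ 2 = A ^ 2 / a * (1 + Real.tanh (a * y)) := by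
  rw [L2.norm_sq_eq_integral]
  refine (integral_congr_ae (g := fun t => A ^ 2 * (1 - Real.tanh (a * (t - y)) ^ 2)) ?_).trans ?_
  · filter_upwards [coeFn_sechH1 A a y h] with t ht
    rw [ht, norm_sech_sq]
  rw [integral_Ioi_of_hasDerivAt_of_nonneg' (g := fun t => A ^ 2 / a * Real.tanh (a * (t - y)))
    (fun t _ => ((hasDerivAt_tanh_affine a y t).const_mul _).congr_deriv (by field_simp))
    (fun t _ => mul_nonneg (sq_nonneg _) (sub_nonneg.mpr (tanh_sq_le_one _)))
    ((tendsto_tanh_affine ha y).const_mul _)]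
  rw [show a * (0 - y) = -(a * y) by ring, Real.tanh_neg]
  ring

theorem norm_sq_deriv_sechH1 {A a y : ℝ} (ha : 0 < a) (h : a = 0 → A = 0) :
    ‖(sechH1 A a y h).1.2‖ ^ 2 = A ^ 2 * a / 3 * (1 + Real.tanh (a * y) ^ 3) := by
  rw [L2.norm_sq_eq_integral]
  refine (integral_congr_ae (g := fun t => A ^ 2 * a ^ 2 *
    (Real.tanh (a * (t - y)) ^ 2 * (1 - Real.tanh (a * (t - y)) ^ 2))) ?_).trans ?_
  · filter_upwards [coeFn_deriv_sechH1 A a y h] with t ht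
    rw [ht, norm_deriv_sech_sq]
  rw [integral_Ioi_of_hasDerivAt_of_nonneg'
    (g := fun t => A ^ 2 * a / 3 * Real.tanh (a * (t - y)) ^ 3)
    (fun t _ => (((hasDerivAt_tanh_affine a y t).pow 3).const_mul _).congr_deriv
      (by push_cast; ring))
    (fun t _ => mul_nonneg (by positivity) (mul_nonneg (sq_nonneg _)
      (sub_nonneg.mpr (tanh_sq_le_one _))))
    (((tendsto_tanh_affine ha y).pow 3).const_mul _)]
  rw [show a * (0 - y) = -(a * y) by ring, Real.tanh_neg]
  ring

theorem integral_norm_sechH1_pow_four {A a y : ℝ} (ha : 0 < a) (h : a = 0 → A = 0) :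
    ∫ t in Ioi (0 : ℝ), ‖(sechH1 A a y h).1.1 t‖ ^ 4
      = A ^ 4 / a * (2 / 3 + Real.tanh (a * y) - Real.tanh (a * y) ^ 3 / 3) := by
  refine (integral_congr_ae
    (g := fun t => A ^ 4 * (1 - Real.tanh (a * (t - y)) ^ 2) ^ 2) ?_).trans ?_
  · filter_upwards [coeFn_sechH1 A a y h] with t ht
    rw [ht, show ‖sech A a y t‖ ^ 4 = (‖sech A a y t‖ ^ 2) ^ 2 by ring, norm_sech_sq]
    ring
  rw [integral_Ioi_of_hasDerivAt_of_nonneg'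
    (g := fun t => A ^ 4 / a * (Real.tanh (a * (t - y)) - Real.tanh (a * (t - y)) ^ 3 / 3))
    (fun t _ => (((hasDerivAt_tanh_affine a y t).sub
      (((hasDerivAt_tanh_affine a y t).pow 3).div_const 3)).const_mul _).congr_deriv
      (by push_cast; field_simp))
    (fun t _ => by positivity)
    (((tendsto_tanh_affine ha y).sub
      (((tendsto_tanh_affine ha y).pow 3).div_const 3)).const_mul _)]
  rw [show a * (0 - y) = -(a * y) by ring, Real.tanh_neg]
  ring

theorem edgeEnergy_sechH1 {A a y : ℝ} (ha : 0 < a) (h : a = 0 → A = 0) :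
    edgeEnergy (sechH1 A a y h) = A ^ 2 * a / 6 * (1 + Real.tanh (a * y) ^ 3)
      - A ^ 4 / (4 * a) * (2 / 3 + Real.tanh (a * y) - Real.tanh (a * y) ^ 3 / 3) := by
  rw [edgeEnergy, norm_sq_deriv_sechH1 ha, integral_norm_sechH1_pow_four ha]
  field_simp
  ring

theorem hasTrace_sechH1 (A a y : ℝ) (h : a = 0 → A = 0) :
    HasTrace (sechH1 A a y h).1.1 (sech A a y 0) :=
  ⟨_, (continuous_sech A a y).continuousOn, coeFn_sechH1 A a y h, rfl⟩

/-- The contributions of `x` are odd in `tanh (m₂ x / 4)` and cancel between the second and third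
edges. -/
theorem mass_sesqui {m₁ m₂ : ℝ} (h₁ : 0 < m₁) (h₂ : 0 < m₂) (x : ℝ) :
    mass (sesqui m₁ m₂ x) = m₁ + m₂ := by
  have hs : √2 ^ 2 = (2 : ℝ) := Real.sq_sqrt (by norm_num)
  simp only [mass, comp, sesqui, Fin.sum_univ_three, Matrix.cons_val]
  rw [norm_sq_sechH1 (by positivity), norm_sq_sechH1 (by positivity),
    norm_sq_sechH1 (by positivity), mul_neg, Real.tanh_neg, mul_zero, Real.tanh_zero,
    div_pow, div_pow, mul_pow, hs]
  field_simp
  ring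

theorem energy_sesqui {m₁ m₂ : ℝ} (h₁ : 0 < m₁) (h₂ : 0 < m₂) (x : ℝ) :
    energy (sesqui m₁ m₂ x) = -(m₁ ^ 3 / 24) - m₂ ^ 3 / 96 := by
  have hs : √2 ^ 2 = (2 : ℝ) := Real.sq_sqrt (by norm_num)
  have hs4 : √2 ^ 4 = (4 : ℝ) := by rw [show √2 ^ 4 = (√2 ^ 2) ^ 2 by ring, hs]; norm_num
  rw [energy_eq_sum]
  simp only [sesqui, Fin.sum_univ_three, Matrix.cons_val]
  rw [edgeEnergy_sechH1 (by positivity), edgeEnergy_sechH1 (by positivity),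
    edgeEnergy_sechH1 (by positivity), mul_neg, Real.tanh_neg, mul_zero, Real.tanh_zero,
    div_pow, div_pow, div_pow, div_pow, mul_pow, mul_pow, hs, hs4]
  field_simp
  ring

/-- The last condition of `Admissible` is the equality of the vertex values of the first and second
edges; the third follows since `cosh` is even. -/
theorem continuousAtVertex_sesqui {m₁ m₂ x : ℝ} (h : Admissible m₁ m₂ x) :
    ContinuousAtVertex (sesqui m₁ m₂ x) := by
  have e1 : sech (m₂ / (2 * √2)) (m₂ / 4) x 0 = sech (m₁ / √2) (m₁ / 2) 0 0 := by
    simp only [sech]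
    congr 1
    rw [show m₂ / 4 * (0 - x) = -(m₂ / 4 * x) by ring, Real.cosh_neg, sub_zero, mul_zero,
      Real.cosh_zero, inv_one, mul_one, h.2.2.2]
    field_simp
  have e2 : sech (m₂ / (2 * √2)) (m₂ / 4) (-x) 0 = sech (m₁ / √2) (m₁ / 2) 0 0 := by
    rw [← e1]
    simp only [sech]
    rw [show m₂ / 4 * (0 - x) = -(m₂ / 4 * (0 - -x)) by ring, Real.cosh_neg]
  refine ⟨sech (m₁ / √2) (m₁ / 2) 0 0, fun i => ?_⟩
  fin_cases i
  · exact hasTrace_sechH1 _ _ _ fun h0 => by simp [show m₁ = 0 by linarith]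
  · rw [← e1]
    exact hasTrace_sechH1 _ _ _ fun h0 => by simp [show m₂ = 0 by linarith]
  · rw [← e2]
    exact hasTrace_sechH1 _ _ _ fun h0 => by simp [show m₂ = 0 by linarith]

/-! ### Continuous dependence of the profiles on their parameters -/

/-- The bounds `K`, `c`, `B` are common to nearby parameters, which provides a single dominating
function. -/
theorem norm_sech_le {A a y B c K : ℝ} (hA : |A| ≤ K) (hc : c ≤ a) (hy : a * y ≤ B) {t : ℝ}
    (ht : 0 ≤ t) : ‖sech A a y t‖ ≤ 2 * K * Real.exp B * Real.exp (-c * t) := by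
  rw [sech, Complex.norm_real, norm_mul, Real.norm_eq_abs, Real.norm_of_nonneg
    (inv_nonneg.mpr (Real.cosh_pos _).le)]
  have h1 : (Real.cosh (a * (t - y)))⁻¹ ≤ 2 * (Real.exp B * Real.exp (-c * t)) := by
    rw [← Real.exp_add, inv_le_iff_one_le_mul₀ (Real.cosh_pos _)]
    have h2 : Real.exp (a * (t - y)) ≤ 2 * Real.cosh (a * (t - y)) := by
      rw [Real.cosh_eq]; linarith [Real.exp_pos (-(a * (t - y)))]
    have h3 : 1 ≤ Real.exp (B + -c * t) * Real.exp (a * (t - y)) := by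
      rw [← Real.exp_add]
      exact Real.one_le_exp (by nlinarith)
    nlinarith [mul_le_mul_of_nonneg_left h2 (Real.exp_pos (B + -c * t)).le]
  calc |A| * (Real.cosh (a * (t - y)))⁻¹ ≤ K * (2 * (Real.exp B * Real.exp (-c * t))) := by
        gcongr; exact (abs_nonneg A).trans hA
    _ = _ := by ring

theorem norm_deriv_sech_le (A a y t : ℝ) : ‖deriv (sech A a y) t‖ ≤ |a| * ‖sech A a y t‖ := by
  refine le_of_sq_le_sq ?_ (by positivity)
  rw [norm_deriv_sech_sq, mul_pow, norm_sech_sq, sq_abs]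
  have h1 := tanh_sq_le_one (a * (t - y))
  have h2 : 0 ≤ A ^ 2 * a ^ 2 * (1 - Real.tanh (a * (t - y)) ^ 2) :=
    mul_nonneg (by positivity) (by linarith)
  nlinarith

/-- Dominated convergence applied to `‖f i - g‖²`, with majorant `(2K)² exp (-2 c t)`. -/
theorem tendsto_toLp_of_exp_bound {ι : Type*} {l : Filter ι} [l.IsCountablyGenerated]
    {f : ι → ℝ → ℂ} {g : ℝ → ℂ} (hf : ∀ i, MemLp (f i) 2 halfLine) (hg : MemLp g 2 halfLine)
    {K c : ℝ} (hc : 0 < c) (hfb : ∀ᶠ i in l, ∀ t, 0 < t → ‖f i t‖ ≤ K * Real.exp (-c * t))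
    (hgb : ∀ t, 0 < t → ‖g t‖ ≤ K * Real.exp (-c * t))
    (hlim : ∀ t, 0 < t → Tendsto (fun i => f i t) l (𝓝 (g t))) :
    Tendsto (fun i => (hf i).toLp (f i)) l (𝓝 (hg.toLp g)) := by
  rw [tendsto_iff_norm_sub_tendsto_zero]
  have key : Tendsto (fun i => ‖(hf i).toLp (f i) - hg.toLp g‖ ^ 2) l (𝓝 0) := by
    have e1 : ∀ i, ‖(hf i).toLp (f i) - hg.toLp g‖ ^ 2
        = ∫ t in Ioi (0 : ℝ), ‖f i t - g t‖ ^ 2 := fun i => by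
      rw [← MemLp.toLp_sub, L2.norm_sq_eq_integral]
      refine integral_congr_ae ?_
      filter_upwards [((hf i).sub hg).coeFn_toLp] with t ht
      rw [ht, Pi.sub_apply]
    simp only [e1]
    have := tendsto_integral_filter_of_dominated_convergence (μ := halfLine) (l := l)
      (F := fun i t => ‖f i t - g t‖ ^ 2) (f := fun _ => (0 : ℝ))
      (fun t => (2 * K) ^ 2 * Real.exp (-(2 * c) * t))
      (Eventually.of_forall fun i => ((hf i).1.sub hg.1).norm.pow 2) ?_ ?_ ?_
    · simpa using this
    · filter_upwards [hfb] with i hi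
      filter_upwards [ae_restrict_mem measurableSet_Ioi] with t ht
      have e2 : Real.exp (-(2 * c) * t) = Real.exp (-c * t) ^ 2 := by
        rw [← Real.exp_nat_mul]; congr 1; push_cast; ring
      rw [Real.norm_of_nonneg (by positivity), e2, ← mul_pow]
      refine pow_le_pow_left₀ (norm_nonneg _) ((norm_sub_le _ _).trans ?_) 2
      linarith [hi t ht, hgb t ht]
    · exact (exp_neg_integrableOn_Ioi 0 (show 0 < 2 * c by positivity)).const_mul _
    · filter_upwards [ae_restrict_mem measurableSet_Ioi] with t ht
      simpa using ((hlim t ht).sub_const (g t)).norm.pow 2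
  have := key.sqrt
  simpa [Real.sqrt_sq] using this

/-- The profiles depend continuously in `H¹(ℝ⁺)` on their parameters. -/
theorem tendsto_sechH1 {ι : Type*} {l : Filter ι} [l.IsCountablyGenerated]
    {A a y : ι → ℝ} {A₀ a₀ y₀ : ℝ} (h : ∀ i, a i = 0 → A i = 0) (h₀ : a₀ = 0 → A₀ = 0)
    (ha₀ : 0 < a₀) (hA : Tendsto A l (𝓝 A₀)) (ha : Tendsto a l (𝓝 a₀))
    (hy : Tendsto y l (𝓝 y₀)) :
    Tendsto (fun i => sechH1 (A i) (a i) (y i) (h i)) l (𝓝 (sechH1 A₀ a₀ y₀ h₀)) := by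
  have hz : ∀ t, Tendsto (fun i => a i * (t - y i)) l (𝓝 (a₀ * (t - y₀))) := fun t =>
    ha.mul (hy.const_sub t)
  have hch : ∀ t, Tendsto (fun i => (Real.cosh (a i * (t - y i)))⁻¹) l
      (𝓝 (Real.cosh (a₀ * (t - y₀)))⁻¹) := fun t =>
    ((Real.continuous_cosh.tendsto _).comp (hz t)).inv₀ (Real.cosh_pos _).ne'
  have hsh : ∀ t, Tendsto (fun i => Real.sinh (a i * (t - y i))) l
      (𝓝 (Real.sinh (a₀ * (t - y₀)))) := fun t => (Real.continuous_sinh.tendsto _).comp (hz t)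
  have hlim : ∀ t, Tendsto (fun i => sech (A i) (a i) (y i) t) l (𝓝 (sech A₀ a₀ y₀ t)) :=
    fun t => (Complex.continuous_ofReal.tendsto _).comp (hA.mul (hch t))
  have hlim' : ∀ t, Tendsto (fun i => deriv (sech (A i) (a i) (y i)) t) l
      (𝓝 (deriv (sech A₀ a₀ y₀) t)) := fun t => by
    simp only [deriv_sech]
    exact (Complex.continuous_ofReal.tendsto _).comp
      (((hA.mul ha).mul (hsh t)).mul ((hch t).pow 2)).neg
  set K := |A₀| + 1
  set B := a₀ * y₀ + 1
  have hK : 0 ≤ 2 * K * Real.exp B := by positivity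
  have b0 : ∀ t, 0 < t → ‖sech A₀ a₀ y₀ t‖ ≤ 2 * K * Real.exp B * Real.exp (-(a₀ / 2) * t) :=
    fun t ht => norm_sech_le (by simp [K]) (by linarith) (by simp [B]) ht.le
  have ev : ∀ᶠ i in l, |A i| ≤ K ∧ a₀ / 2 ≤ a i ∧ a i ≤ 2 * a₀ ∧ a i * y i ≤ B := by
    filter_upwards [hA.abs.eventually (Iic_mem_nhds (show |A₀| < K by simp [K])),
      ha.eventually (Ici_mem_nhds (show a₀ / 2 < a₀ by linarith)),
      ha.eventually (Iic_mem_nhds (show a₀ < 2 * a₀ by linarith)),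
      (ha.mul hy).eventually (Iic_mem_nhds (show a₀ * y₀ < B by simp [B]))] with i h1 h2 h3 h4
    exact ⟨h1, h2, h3, h4⟩
  have bd : ∀ᶠ i in l, ∀ t, 0 < t →
      ‖sech (A i) (a i) (y i) t‖ ≤ 2 * K * Real.exp B * Real.exp (-(a₀ / 2) * t) := by
    filter_upwards [ev] with i hi t ht
    exact norm_sech_le hi.1 hi.2.1 hi.2.2.2 ht.le
  rw [tendsto_subtype_rng]
  refine Tendsto.prodMk_nhds ?_ ?_
  · exact tendsto_toLp_of_exp_bound (fun i => memLp_sech _ _ _ (h i)) (memLp_sech _ _ _ h₀)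
      (half_pos ha₀) bd b0 fun t _ => hlim t
  · refine tendsto_toLp_of_exp_bound (K := 2 * a₀ * (2 * K * Real.exp B))
      (fun i => memLp_deriv_sech _ _ _ (h i)) (memLp_deriv_sech _ _ _ h₀)
      (half_pos ha₀) ?_ (fun t ht => ?_) fun t _ => hlim' t
    · filter_upwards [bd, ev] with i hi hi' t ht
      rw [mul_assoc]
      have h1 : |a i| ≤ 2 * a₀ := by
        rw [abs_of_nonneg (by linarith [hi'.2.1])]; exact hi'.2.2.1
      exact (norm_deriv_sech_le _ _ _ t).trans
        (mul_le_mul h1 (hi t ht) (norm_nonneg _) (by positivity))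
    · rw [mul_assoc]
      have h1 : |a₀| ≤ 2 * a₀ := by rw [abs_of_pos ha₀]; linarith
      exact (norm_deriv_sech_le _ _ _ t).trans
        (mul_le_mul h1 (b0 t ht) (norm_nonneg _) (by positivity))

/-! ### The half-soliton and the stationary equation -/

/-- The half-soliton `√2 a / cosh (a t)`. -/
def soliton (a : ℝ) : H1 := sechH1 (√2 * a) a 0 (fun h => by simp [h])

theorem sechH1_congr {A a y A' a' y' : ℝ} (h : a = 0 → A = 0) (h' : a' = 0 → A' = 0)
    (hA : A = A') (ha : a = a') (hy : y = y') : sechH1 A a y h = sechH1 A' a' y' h' := by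
  subst hA ha hy; rfl

theorem div_eq_zero_of_div_eq_zero {m c d : ℝ} (hd : d ≠ 0) (h : m / d = 0) : m / c = 0 := by
  rw [(div_eq_zero_iff.mp h).resolve_right hd, zero_div]

theorem sesqui_eq_soliton (M : ℝ) :
    sesqui (M / 3) (2 * M / 3) 0 = fun _ => soliton (M / 6) := by
  have hs : √2 ^ 2 = (2 : ℝ) := Real.sq_sqrt (by norm_num)
  funext i
  fin_cases i
  · refine sechH1_congr (div_eq_zero_of_div_eq_zero (by norm_num)) _ ?_ (by ring) rfl
    field_simp
    rw [hs]; ring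
  · refine sechH1_congr (div_eq_zero_of_div_eq_zero (by norm_num)) _ ?_ (by ring) rfl
    field_simp
    rw [hs]; ring
  · refine sechH1_congr (div_eq_zero_of_div_eq_zero (by norm_num)) _ ?_ (by ring) (by simp)
    field_simp
    rw [hs]; ring

/-- The real profile `√2 a / cosh (a t)`. -/
def solitonProfile (a t : ℝ) : ℝ := √2 * a * (Real.cosh (a * t))⁻¹

/-- The derivative of `solitonProfile`. -/
def solitonProfileDeriv (a t : ℝ) : ℝ :=
  -(√2 * a * a * Real.sinh (a * t) * (Real.cosh (a * t))⁻¹ ^ 2)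

theorem sech_eq_solitonProfile (a : ℝ) :
    sech (√2 * a) a 0 = fun t => (solitonProfile a t : ℂ) := by
  funext t; simp [sech, solitonProfile]

theorem deriv_sech_eq_solitonProfileDeriv (a : ℝ) :
    deriv (sech (√2 * a) a 0) = fun t => (solitonProfileDeriv a t : ℂ) := by
  rw [deriv_sech]; funext t; simp [solitonProfileDeriv]

theorem hasDerivAt_solitonProfileDeriv (a t : ℝ) : HasDerivAt (solitonProfileDeriv a)
    (a ^ 2 * solitonProfile a t - solitonProfile a t ^ 3) t := by
  have hc := (Real.cosh_pos (a * t)).ne'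
  have hs : √2 ^ 2 = (2 : ℝ) := Real.sq_sqrt (by norm_num)
  have h1 : HasDerivAt (fun t : ℝ => a * t) a t := by
    simpa using (hasDerivAt_id t).const_mul a
  have h2 := ((h1.sinh.const_mul (√2 * a * a)).fun_mul ((h1.cosh.fun_inv hc).fun_pow 2)).fun_neg
  refine (h2.congr_deriv ?_ :)
  rw [solitonProfile, show ∀ x : ℝ, (√2 * a * x) ^ 3 = √2 ^ 2 * √2 * a ^ 3 * x ^ 3 by
    intro x; ring, hs, show 2 - 1 = 1 from rfl, pow_one]
  field_simp
  have := Real.cosh_sq (a * t)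
  rw [show Real.sinh (a * t) ^ 2 = Real.cosh (a * t) ^ 2 - 1 by linarith]
  ring

theorem continuous_solitonProfile (a : ℝ) : Continuous (solitonProfile a) := by
  have := continuous_inv_cosh a 0
  simp only [sub_zero] at this
  exact continuous_const.mul this

theorem contDiff_solitonProfileDeriv (a : ℝ) : ContDiff ℝ 1 (solitonProfileDeriv a) := by
  rw [contDiff_one_iff_deriv]
  refine ⟨fun t => (hasDerivAt_solitonProfileDeriv a t).differentiableAt, ?_⟩
  rw [funext fun t => (hasDerivAt_solitonProfileDeriv a t).deriv]
  have := continuous_solitonProfile a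
  fun_prop

theorem coeFn_soliton (a : ℝ) :
    ∀ᵐ t ∂halfLine, (soliton a).1.1 t = (solitonProfile a t : ℂ) := by
  filter_upwards [coeFn_sechH1 (√2 * a) a 0 (fun h => by simp [h])] with t ht
  rw [soliton, ht, sech_eq_solitonProfile]

theorem coeFn_deriv_soliton (a : ℝ) :
    ∀ᵐ t ∂halfLine, (soliton a).1.2 t = (solitonProfileDeriv a t : ℂ) := by
  filter_upwards [coeFn_deriv_sechH1 (√2 * a) a 0 (fun h => by simp [h])] with t ht
  rw [soliton, ht, deriv_sech_eq_solitonProfileDeriv]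

theorem memLp_soliton_second_deriv (a : ℝ) :
    MemLp (fun t => ((a ^ 2 * solitonProfile a t - solitonProfile a t ^ 3 : ℝ) : ℂ)) 2
      halfLine := by
  refine (((Lp.memLp (soliton a).1.1).const_mul ((a : ℂ) ^ 2)).sub
    (memLp_cubic (soliton a))).ae_eq ?_
  filter_upwards [coeFn_soliton a] with t ht
  simp only [Pi.sub_apply, ht, Complex.norm_real, Real.norm_eq_abs, sq_abs, Complex.real_smul]
  push_cast
  ring

theorem hasDerivAt_ofReal_solitonProfileDeriv (a t : ℝ) :
    HasDerivAt (fun t => (solitonProfileDeriv a t : ℂ))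
      ((a ^ 2 * solitonProfile a t - solitonProfile a t ^ 3 : ℝ) : ℂ) t :=
  (hasDerivAt_solitonProfileDeriv a t).ofReal_comp

/-- The derivative of the half-soliton has a weak derivative, given by the stationary equation. -/
theorem hasWeakDeriv_soliton (a : ℝ) :
    HasWeakDeriv (soliton a).1.2 ((memLp_soliton_second_deriv a).toLp _) := by
  have hd : deriv (fun t => (solitonProfileDeriv a t : ℂ))
      = fun t => ((a ^ 2 * solitonProfile a t - solitonProfile a t ^ 3 : ℝ) : ℂ) :=
    funext fun t => (hasDerivAt_ofReal_solitonProfileDeriv a t).deriv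
  have h0 : MemLp (fun t => (solitonProfileDeriv a t : ℂ)) 2 halfLine :=
    (Lp.memLp (soliton a).1.2).ae_eq (coeFn_deriv_soliton a)
  have h1 : MemLp (deriv fun t => (solitonProfileDeriv a t : ℂ)) 2 halfLine := by
    rw [hd]; exact memLp_soliton_second_deriv a
  -- The derivative of the profile is itself an `H1` function, and its membership proof is the
  -- required weak derivative relation.
  have h := (ofFun (fun t => (solitonProfileDeriv a t : ℂ))
    (Complex.ofRealCLM.contDiff.comp (contDiff_solitonProfileDeriv a)) h0 h1).2
  have e0 : h0.toLp _ = (soliton a).1.2 := by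
    refine Lp.ext ?_
    filter_upwards [h0.coeFn_toLp, coeFn_deriv_soliton a] with t h2 h3
    rw [h2, h3]
  have e1 : h1.toLp _ = (memLp_soliton_second_deriv a).toLp _ :=
    MemLp.toLp_congr _ _ (by rw [hd])
  rw [← e0, ← e1]
  exact h

theorem norm_sq_soliton {a : ℝ} (ha : 0 < a) : ‖(soliton a).1.1‖ ^ 2 = 2 * a := by
  rw [soliton, norm_sq_sechH1 ha, mul_pow, Real.sq_sqrt (by norm_num), mul_zero, Real.tanh_zero]
  field_simp
  ring

theorem edgeEnergy_soliton {a : ℝ} (ha : 0 < a) : edgeEnergy (soliton a) = -(a ^ 3 / 3) := by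
  have hs : √2 ^ 2 = (2 : ℝ) := Real.sq_sqrt (by norm_num)
  rw [soliton, edgeEnergy_sechH1 ha, show (√2 * a) ^ 4 = (√2 ^ 2) ^ 2 * a ^ 4 by ring, mul_pow,
    hs, mul_zero, Real.tanh_zero]
  field_simp
  ring

theorem hasTrace_deriv_soliton (a : ℝ) : HasTrace (soliton a).1.2 0 :=
  ⟨_, (Complex.continuous_ofReal.comp (contDiff_solitonProfileDeriv a).continuous).continuousOn,
    coeFn_deriv_soliton a, by simp [solitonProfileDeriv]⟩

theorem continuousAtVertex_const_sechH1 (A a y : ℝ) (h : a = 0 → A = 0) :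
    ContinuousAtVertex (fun _ => sechH1 A a y h) :=
  ⟨_, fun _ => hasTrace_sechH1 A a y h⟩

theorem solvesStationaryNLS_soliton (a : ℝ) :
    SolvesStationaryNLS (fun _ => soliton a) (a ^ 2) := by
  refine ⟨fun _ => (memLp_soliton_second_deriv a).toLp _, ⟨fun _ => hasWeakDeriv_soliton a,
    continuousAtVertex_const_sechH1 _ _ _ _, fun _ => 0, fun _ => hasTrace_deriv_soliton a,
    by simp⟩, fun i => ?_⟩
  filter_upwards [coeFn_soliton a, (memLp_soliton_second_deriv a).coeFn_toLp] with t h1 h2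
  rw [h2, comp, h1, Complex.norm_real, Real.norm_eq_abs, sq_abs]
  push_cast
  ring

/-- The half-soliton is a critical point of the edge energy, without any condition on the variation
at the origin. -/
theorem edgeEnergyDeriv_soliton (a : ℝ) (h : H1) :
    edgeEnergyDeriv (soliton a) h + a ^ 2 * (inner ℂ (soliton a).1.1 h.1.1 : ℂ).re = 0 := by
  obtain ⟨f, hf, hfu⟩ := HasWeakDeriv.exists_hasACDeriv h.2 Complex.reCLM
  simp only [Complex.reCLM_apply] at hf hfu
  rw [edgeEnergyDeriv_apply, L2.re_inner_eq_integral]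
  have i1 : Integrable (fun t => solitonProfileDeriv a t * (h.1.2 t).re) halfLine :=
    (L2.integrable_re_inner (soliton a).1.2 h.1.2).congr (by
      filter_upwards [coeFn_deriv_soliton a] with t ht
      rw [ht, Complex.ofReal_re, Complex.ofReal_im, zero_mul, add_zero])
  have i2 : Integrable (fun t => (a ^ 2 * solitonProfile a t - solitonProfile a t ^ 3)
      * (h.1.1 t).re) halfLine :=
    (L2.integrable_re_inner ((memLp_soliton_second_deriv a).toLp _) h.1.1).congr (by
      filter_upwards [(memLp_soliton_second_deriv a).coeFn_toLp] with t ht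
      rw [ht, Complex.ofReal_re, Complex.ofReal_im, zero_mul, add_zero])
  have i3 : Integrable (fun t => solitonProfileDeriv a t * f t) halfLine :=
    (L2.integrable_re_inner (soliton a).1.2 h.1.1).congr (by
      filter_upwards [coeFn_deriv_soliton a, hfu] with t ht h2
      rw [ht, Complex.ofReal_re, Complex.ofReal_im, zero_mul, add_zero, h2])
  -- The combined integrand is the derivative of `φ' Re h`; only `Re h` enters because `φ` is real.
  -- The boundary term `φ'(0) Re h(0)` vanishes for every `h`, by `e0`.
  have e1 := ((HasACDeriv.of_contDiff (contDiff_solitonProfileDeriv a)).mul hf).congr_deriv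
    (q := fun t => (a ^ 2 * solitonProfile a t - solitonProfile a t ^ 3) * (h.1.1 t).re
      + solitonProfileDeriv a t * (h.1.2 t).re) (by
      filter_upwards [hfu] with t ht
      rw [(hasDerivAt_solitonProfileDeriv a t).deriv, ht])
    |>.integral_Ioi_eq_neg i3 (i2.add i1) le_rfl
  have e0 : solitonProfileDeriv a 0 = 0 := by simp [solitonProfileDeriv]
  have j1 := L2.integrable_re_inner (soliton a).1.2 h.1.2
  have j2 := integrable_cubic_mul (soliton a) h
  have j3 := L2.integrable_re_inner (soliton a).1.1 h.1.1
  rw [← integral_const_mul, ← integral_sub j1 j2]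
  refine (integral_add (j1.sub j2) (j3.const_mul (a ^ 2))).symm.trans ?_
  rw [e0, zero_mul, neg_zero] at e1
  refine (integral_congr_ae ?_).trans e1
  filter_upwards [coeFn_soliton a, coeFn_deriv_soliton a] with t h1 h2
  simp only [Pi.sub_apply, h1, h2, Complex.ofReal_re, Complex.ofReal_im, Complex.norm_real,
    Real.norm_eq_abs, sq_abs]
  ring

theorem energyDeriv_soliton (a : ℝ) (h : H1Graph) :
    energyDeriv (fun _ => soliton a) h + a ^ 2 * (l2Inner (fun _ => soliton a) h).re = 0 := by
  rw [energyDeriv_apply, l2Inner, Complex.re_sum, Finset.mul_sum, ← Finset.sum_add_distrib]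
  exact Finset.sum_eq_zero fun i _ => edgeEnergyDeriv_soliton a (h i)

/-! ### The symmetric state: criticality, symmetric minimum, dilations -/

theorem mass_const (p : H1) : mass (fun _ => p) = 3 * ‖p.1.1‖ ^ 2 := by
  simp [mass, comp]

theorem energy_const (p : H1) : energy (fun _ => p) = 3 * edgeEnergy p := by
  simp [energy_eq_sum]

theorem soliton_mem_massSphere {a : ℝ} (ha : 0 < a) :
    (fun _ => soliton a) ∈ massSphere (6 * a) :=
  ⟨continuousAtVertex_const_sechH1 _ _ _ _, by rw [mass_const, norm_sq_soliton ha]; ring⟩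

theorem isCriticalWithMultiplier_soliton {a : ℝ} (ha : 0 < a) :
    IsCriticalWithMultiplier (6 * a) (fun _ => soliton a) (a ^ 2) :=
  ⟨soliton_mem_massSphere ha, energyDeriv _, hasFDerivAt_energy _,
    fun h _ => energyDeriv_soliton a h⟩

theorem energy_soliton {a : ℝ} (ha : 0 < a) : energy (fun _ => soliton a) = -a ^ 3 := by
  rw [energy_const, edgeEnergy_soliton ha]; ring

/-- Symmetry forces mass `2a` on each edge, so the sharp edge bound applies three times, and the
half-soliton attains it. -/
theorem isMinOn_soliton {a : ℝ} (ha : 0 < a) :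
    IsMinOn energy {Ψ ∈ massSphere (6 * a) | Ψ 0 = Ψ 1 ∧ Ψ 1 = Ψ 2} (fun _ => soliton a) := by
  rintro Ψ ⟨⟨_, hm⟩, h01, h12⟩
  have hΨ : Ψ = fun _ => Ψ 0 := by
    funext i
    fin_cases i
    · rfl
    · exact h01.symm
    · exact (h01.trans h12).symm
  rw [mem_ofPred_eq, energy_soliton ha, hΨ, energy_const]
  rw [hΨ, mass_const] at hm
  have := energy_edge_ge (Ψ 0) ha (by linarith)
  rw [edgeEnergy]
  linarith

/-- Mass preserving dilations of the half-solitons raise the energy. -/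
theorem not_isLocalMaxOn_soliton {a : ℝ} (ha : 0 < a) :
    ¬ IsLocalMaxOn energy (massSphere (6 * a)) (fun _ => soliton a) := by
  intro hmax
  have hs : √2 ^ 2 = (2 : ℝ) := Real.sq_sqrt (by norm_num)
  have hp : ∀ s : ℝ, s ^ 2 * a = 0 → s * (√2 * a) = 0 := fun s h => by
    rcases mul_eq_zero.mp h with h | h
    · simp [pow_eq_zero_iff] at h; simp [h]
    · simp [h]
  set γ : ℝ → H1Graph := fun s _ => sechH1 (s * (√2 * a)) (s ^ 2 * a) 0 (hp s)
  have hγ : Tendsto γ (𝓝[>] 1) (𝓝 (fun _ => soliton a)) := by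
    rw [tendsto_pi_nhds]
    intro _
    have hid : Tendsto (fun s : ℝ => s) (𝓝[>] 1) (𝓝 1) := tendsto_id.mono_left nhdsWithin_le_nhds
    refine tendsto_sechH1 hp _ ha ?_ ?_ tendsto_const_nhds
    · simpa using hid.mul_const (√2 * a)
    · simpa using (hid.pow 2).mul_const a
  have hmem : ∀ᶠ s in 𝓝[>] (1 : ℝ), γ s ∈ massSphere (6 * a) := by
    filter_upwards [self_mem_nhdsWithin] with s hs1
    have hs0 : (0 : ℝ) < s := one_pos.trans hs1
    refine ⟨continuousAtVertex_const_sechH1 _ _ _ _, ?_⟩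
    rw [mass_const, norm_sq_sechH1 (by positivity), mul_pow, mul_pow, hs, mul_zero, Real.tanh_zero]
    field_simp
    ring
  have hev := (tendsto_nhdsWithin_iff.mpr ⟨hγ, hmem⟩).eventually hmax
  obtain ⟨s, hle, hs1⟩ := (hev.and self_mem_nhdsWithin).exists
  have hs1 : 1 < s := hs1
  have hs0 : 0 < s := one_pos.trans hs1
  have hE : energy (γ s) = a ^ 3 * (s ^ 4 - 2 * s ^ 2) := by
    rw [energy_const, edgeEnergy_sechH1 (by positivity),
      show (s * (√2 * a)) ^ 4 = s ^ 4 * ((√2 ^ 2) ^ 2 * a ^ 4) by ring, mul_pow, mul_pow, hs,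
      mul_zero, Real.tanh_zero]
    field_simp
    ring
  rw [hE, energy_soliton ha] at hle
  -- The energy gain is `a³ (s² - 1)²`, strictly positive because `s > 1`.
  have h2 : 0 < s ^ 2 - 1 := by nlinarith
  have h3 : 0 < a ^ 3 * (s ^ 2 - 1) ^ 2 := by positivity
  nlinarith

/-! ### The curve of sesquisolitons -/

/-- The position parameter of the sesquisoliton of mass `M` with parameter `m₁`. -/
def position (M m₁ : ℝ) : ℝ := 4 / (M - m₁) * Real.arcosh ((M - m₁) / (2 * m₁))

/-- The curve of the sesquisolitons of mass `M`. -/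
def curve (M m₁ : ℝ) : H1Graph := sesqui m₁ (M - m₁) (position M m₁)

section Curve

variable {M : ℝ}

theorem one_le_ratio {m : ℝ} (hm : m ∈ Ioc 0 (M / 3)) : 1 ≤ (M - m) / (2 * m) := by
  rw [le_div_iff₀ (by linarith [hm.1])]
  linarith [hm.2]

theorem position_endpoint (hM : 0 < M) : position M (M / 3) = 0 := by
  rw [position, show (M - M / 3) / (2 * (M / 3)) = 1 by field_simp; ring, Real.arcosh_zero,
    mul_zero]

theorem admissible_position {m : ℝ} (hm : m ∈ Ioc 0 (M / 3)) :
    Admissible m (M - m) (position M m) := by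
  have h0 : 0 < m := hm.1
  have h1 : 0 < M - m := by linarith [hm.2]
  have h2 := one_le_ratio hm
  refine ⟨h0, by linarith [hm.2], mul_nonneg (by positivity) (Real.arcosh_nonneg h2), ?_⟩
  rw [position, ← mul_assoc, show (M - m) / 4 * (4 / (M - m)) = 1 by field_simp, one_mul,
    Real.cosh_arcosh h2]
  field_simp

theorem Admissible.pos {m₁ m₂ x : ℝ} (h : Admissible m₁ m₂ x) : 0 < m₁ ∧ 0 < m₂ :=
  ⟨h.1, h.1.trans_le h.2.1⟩

/-- Since `cosh ≥ 1`, the matching condition gives `m₁ ≤ m₂ / 2`, that is `m₁ ≤ M / 3`. As `x ≥ 0`,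
`arcosh` recovers `x`; hence the curve misses no sesquisoliton. -/
theorem Admissible.eq_position {m₁ m₂ x : ℝ} (h : Admissible m₁ m₂ x) (hM : m₁ + m₂ = M) :
    m₁ ∈ Ioc 0 (M / 3) ∧ m₂ = M - m₁ ∧ x = position M m₁ := by
  obtain ⟨h1, h2⟩ := h.pos
  have hc := Real.one_le_cosh (m₂ / 4 * x)
  have hx := h.2.2.2
  have hm : M - m₁ = m₂ := by linarith
  have e1 : m₁ * Real.cosh (m₂ / 4 * x) = m₂ / 2 := by
    rw [eq_mul_inv_iff_mul_eq₀ (by positivity)] at hx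
    exact hx
  have e2 : (M - m₁) / (2 * m₁) = Real.cosh (m₂ / 4 * x) := by
    rw [hm, div_eq_iff (by positivity)]; linarith
  refine ⟨⟨h1, by nlinarith⟩, hm.symm, ?_⟩
  rw [position, e2, Real.arcosh_cosh (mul_nonneg (by positivity) h.2.2.1), hm]
  field_simp

theorem continuousOn_position : ContinuousOn (position M) (Ioc 0 (M / 3)) := by
  have h1 : ∀ m ∈ Ioc 0 (M / 3), M - m ≠ 0 := fun m hm => by linarith [hm.1, hm.2]
  have h2 : ∀ m ∈ Ioc 0 (M / 3), 2 * m ≠ 0 := fun m hm => by linarith [hm.1]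
  refine (continuousOn_const.div (by fun_prop) h1).mul (Real.continuousOn_arcosh.comp
    (ContinuousOn.div (by fun_prop) (by fun_prop) h2) fun m hm => one_le_ratio hm)

theorem continuousOn_curve : ContinuousOn (curve M) (Ioc 0 (M / 3)) := by
  intro m hm
  have h0 : 0 < m := hm.1
  have h1 : 0 < M - m := by linarith [hm.2]
  have hp : Tendsto (position M) (𝓝[Ioc 0 (M / 3)] m) (𝓝 (position M m)) :=
    continuousOn_position m hm
  have hid : Tendsto (fun m : ℝ => m) (𝓝[Ioc 0 (M / 3)] m) (𝓝 m) :=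
    tendsto_id.mono_left nhdsWithin_le_nhds
  refine tendsto_pi_nhds.mpr fun i => ?_
  fin_cases i
  · exact tendsto_sechH1 (fun _ => div_eq_zero_of_div_eq_zero (by norm_num))
      (div_eq_zero_of_div_eq_zero (by norm_num)) (by positivity) (hid.div_const _) (hid.div_const _)
      tendsto_const_nhds
  · exact tendsto_sechH1 (fun _ => div_eq_zero_of_div_eq_zero (by norm_num))
      (div_eq_zero_of_div_eq_zero (by norm_num)) (by positivity) ((hid.const_sub M).div_const _)
      ((hid.const_sub M).div_const _) hp
  · exact tendsto_sechH1 (fun _ => div_eq_zero_of_div_eq_zero (by norm_num))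
      (div_eq_zero_of_div_eq_zero (by norm_num)) (by positivity) ((hid.const_sub M).div_const _)
      ((hid.const_sub M).div_const _) hp.neg

theorem curve_mem_sesquisolitons {m : ℝ} (hm : m ∈ Ioc 0 (M / 3)) :
    curve M m ∈ sesquisolitons M :=
  ⟨⟨_, _, _, admissible_position hm, rfl⟩, by
    rw [curve, mass_sesqui hm.1 (by linarith [hm.1, hm.2])]; ring⟩

theorem image_curve : curve M '' Ioc 0 (M / 3) = sesquisolitons M := by
  refine Subset.antisymm (image_subset_iff.mpr fun m hm => curve_mem_sesquisolitons hm) ?_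
  rintro _ ⟨⟨m₁, m₂, x, h, rfl⟩, hM⟩
  obtain ⟨h1, h2⟩ := h.pos
  rw [mass_sesqui h1 h2] at hM
  obtain ⟨h3, h4, h5⟩ := h.eq_position hM
  exact ⟨m₁, h3, by rw [curve, ← h4, ← h5]⟩

/-- The difference of the energies at `t` and `s`, times 96, is `t - s` times the gap between the
two sides of `h3`. The gap is positive because `2t ≤ M - t < M - s`. -/
theorem strictMonoOn_energy_curve : StrictMonoOn (fun m => energy (curve M m)) (Ioc 0 (M / 3)) := by
  intro s hs t ht hst
  have hs0 := hs.1
  have ht1 := ht.2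
  simp only [curve]
  rw [energy_sesqui hs.1 (by linarith), energy_sesqui ht.1 (by linarith [ht.1])]
  have h1 : 2 * t < M - s := by linarith
  have h2 : 2 * t ≤ M - t := by linarith
  have h3 : 4 * (t ^ 2 + t * s + s ^ 2)
      < (M - s) ^ 2 + (M - s) * (M - t) + (M - t) ^ 2 := by nlinarith
  nlinarith [mul_lt_mul_of_pos_left h3 (sub_pos.mpr hst)]

theorem sesquisolitons_subset_massSphere : sesquisolitons M ⊆ massSphere M := by
  rintro _ ⟨⟨m₁, m₂, x, h, rfl⟩, hM⟩
  exact ⟨continuousAtVertex_sesqui h, hM⟩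

theorem curve_endpoint (hM : 0 < M) : curve M (M / 3) = sesqui (M / 3) (2 * M / 3) 0 := by
  rw [curve, position_endpoint hM, show M - M / 3 = 2 * M / 3 by ring]

theorem isMaxOn_energy_sesquisolitons (hM : 0 < M) :
    IsMaxOn energy (sesquisolitons M) (sesqui (M / 3) (2 * M / 3) 0) := by
  rw [← image_curve, ← curve_endpoint hM]
  rintro _ ⟨m, hm, rfl⟩
  exact strictMonoOn_energy_curve.monotoneOn hm ⟨by positivity, le_rfl⟩ hm.2

/-- The energy decreases along the curve of sesquisolitons that ends at the state. -/
theorem not_isLocalMinOn_sesqui (hM : 0 < M) :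
    ¬ IsLocalMinOn energy (massSphere M) (sesqui (M / 3) (2 * M / 3) 0) := by
  intro hmin
  rw [← curve_endpoint hM] at hmin
  have hend : M / 3 ∈ Ioc 0 (M / 3) := ⟨by positivity, le_rfl⟩
  -- The open interval excludes the endpoint, so the approaching states have strictly smaller
  -- energy.
  have hc : Tendsto (curve M) (𝓝[Ioo 0 (M / 3)] (M / 3)) (𝓝[massSphere M] (curve M (M / 3))) := by
    refine tendsto_nhdsWithin_iff.mpr
      ⟨((continuousOn_curve (M / 3) hend).mono Ioo_subset_Ioc_self), ?_⟩
    filter_upwards [self_mem_nhdsWithin] with m hm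
    exact sesquisolitons_subset_massSphere
      (curve_mem_sesquisolitons (Ioo_subset_Ioc_self hm))
  have : (𝓝[Ioo 0 (M / 3)] (M / 3)).NeBot := right_nhdsWithin_Ioo_neBot (by positivity)
  obtain ⟨m, hle, hm⟩ := ((hc.eventually hmin).and self_mem_nhdsWithin).exists
  exact (strictMonoOn_energy_curve (Ioo_subset_Ioc_self hm) hend hm.2).not_ge hle

end Curve

end StarGraph

end

theorem mainTheorem2 (M : ℝ) (hM : 0 < M) :
    -- the state is a sesquisoliton of mass `M`
    StarGraph.Admissible (M / 3) (2 * M / 3) 0 ∧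
    StarGraph.sesqui (M / 3) (2 * M / 3) 0 ∈ StarGraph.sesquisolitons M ∧
    -- Euler-Lagrange equation, critical point on the mass sphere, saddle point
    StarGraph.SolvesStationaryNLS (StarGraph.sesqui (M / 3) (2 * M / 3) 0) (M ^ 2 / 36) ∧
    StarGraph.IsCriticalWithMultiplier M (StarGraph.sesqui (M / 3) (2 * M / 3) 0) (M ^ 2 / 36) ∧
    -- the Lagrange condition even holds against variations that are discontinuous at the vertex
    (∀ h : StarGraph.H1Graph, fderiv ℝ StarGraph.energy (StarGraph.sesqui (M / 3) (2 * M / 3) 0) h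
      + M ^ 2 / 36 * (StarGraph.l2Inner (StarGraph.sesqui (M / 3) (2 * M / 3) 0) h).re = 0) ∧
    StarGraph.IsSaddlePoint M (StarGraph.sesqui (M / 3) (2 * M / 3) 0) ∧
    -- the sesquisolitons of mass `M` form a curve in the sphere, parametrized by `m₁ ∈ (0, M/3]`,
    -- along which the energy increases strictly up to its maximum at the state
    (∃ ξ : ℝ → ℝ, ξ (M / 3) = 0 ∧
      (∀ m₁ ∈ Set.Ioc 0 (M / 3), StarGraph.Admissible m₁ (M - m₁) (ξ m₁)) ∧
      ContinuousOn (fun m₁ => StarGraph.sesqui m₁ (M - m₁) (ξ m₁)) (Set.Ioc 0 (M / 3)) ∧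
      (fun m₁ => StarGraph.sesqui m₁ (M - m₁) (ξ m₁)) '' Set.Ioc 0 (M / 3)
        = StarGraph.sesquisolitons M ∧
      StrictMonoOn (fun m₁ => StarGraph.energy (StarGraph.sesqui m₁ (M - m₁) (ξ m₁)))
        (Set.Ioc 0 (M / 3))) ∧
    StarGraph.sesquisolitons M ⊆ StarGraph.massSphere M ∧
    IsMaxOn StarGraph.energy (StarGraph.sesquisolitons M)
      (StarGraph.sesqui (M / 3) (2 * M / 3) 0) ∧
    -- minimum of the energy on the submanifold of the states with three equal components
    StarGraph.sesqui (M / 3) (2 * M / 3) 0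
      ∈ {Ψ ∈ StarGraph.massSphere M | Ψ 0 = Ψ 1 ∧ Ψ 1 = Ψ 2} ∧
    IsMinOn StarGraph.energy {Ψ ∈ StarGraph.massSphere M | Ψ 0 = Ψ 1 ∧ Ψ 1 = Ψ 2}
      (StarGraph.sesqui (M / 3) (2 * M / 3) 0) := by
  -- Each edge carries mass `M / 3 = 2a`, so `a = M / 6` and the multiplier is `a² = M² / 36`.
  have ha : 0 < M / 6 := by positivity
  have h6 : 6 * (M / 6) = M := by ring
  have hsq : (M / 6) ^ 2 = M ^ 2 / 36 := by ring
  have hend : M / 3 ∈ Set.Ioc 0 (M / 3) := ⟨by positivity, le_rfl⟩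
  have hcrit := StarGraph.isCriticalWithMultiplier_soliton ha
  have hmax := StarGraph.not_isLocalMaxOn_soliton ha
  have hmin := StarGraph.isMinOn_soliton ha
  have hnls := StarGraph.solvesStationaryNLS_soliton (M / 6)
  have hlag := StarGraph.energyDeriv_soliton (M / 6)
  have hfd := (StarGraph.hasFDerivAt_energy (fun _ => StarGraph.soliton (M / 6))).fderiv
  have hsph := StarGraph.soliton_mem_massSphere ha
  rw [h6] at hcrit hmax hmin hsph
  rw [hsq] at hcrit hnls
  simp only [hsq, ← hfd] at hlag
  have hsym : ∀ i j, StarGraph.sesqui (M / 3) (2 * M / 3) 0 i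
      = StarGraph.sesqui (M / 3) (2 * M / 3) 0 j := fun i j => by
    rw [StarGraph.sesqui_eq_soliton]
  have hadm := StarGraph.admissible_position hend
  rw [StarGraph.position_endpoint hM, show M - M / 3 = 2 * M / 3 by ring] at hadm
  have hmem := StarGraph.curve_mem_sesquisolitons hend
  rw [StarGraph.curve_endpoint hM] at hmem
  rw [← StarGraph.sesqui_eq_soliton] at hcrit hmax hmin hnls hlag hsph
  exact ⟨hadm, hmem, hnls, hcrit, hlag,
    ⟨⟨_, hcrit⟩, StarGraph.not_isLocalMinOn_sesqui hM, hmax⟩,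
    ⟨StarGraph.position M, StarGraph.position_endpoint hM,
      fun _ hm => StarGraph.admissible_position hm, StarGraph.continuousOn_curve,
      StarGraph.image_curve, StarGraph.strictMonoOn_energy_curve⟩,
    StarGraph.sesquisolitons_subset_massSphere, StarGraph.isMaxOn_energy_sesquisolitons hM,
    ⟨hsph, hsym 0 1, hsym 1 2⟩, hmin⟩
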